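/- **Conventions.** Maps between topological spaces are continuous. For a point $x$ of a finite $T_0$-space $X$, let $U_x$ be the intersection of all open sets containing $x$, and write $x\le y$ if $x\in U_y$; this is a partial order on $X$. A map $f:X\to Y$ between finite $T_0$-spaces is *distinguished* if $f^{-1}(U_y)$ is contractible for every $y\in Y$. Let $\overline{\mathcal D}$ be the smallest class of maps between finite $T_0$-spaces that contains all distinguished maps and has the 2-out-of-3 property up to homotopy: whenever $f\circ g\simeq h$ and two of the maps $f,g,h$ are in the class, so is the third. For a finite $T_0$-space $X$, $\mathcal K(X)$ is the simplicial complex whose simplices are the non-empty chains of $X$, and for $f:X\to Y$ the simplicial map $\mathcal K(f):\mathcal K(X)\to\mathcal K(Y)$ coincides with $f$ on vertices. For a finite simplicial complex $K$, $\mathcal X(K)$ is the finite $T_0$-space given by the set of simplices of $K$ ordered by inclusion (the open sets are the lower sets), and for a simplicial map $\varphi:K\to L$ the map $\mathcal X(\varphi):\mathcal X(K)\to\mathcal X(L)$ sends $S$ to $\varphi(S)$. Geometric realization is denoted by $|\cdot|$. There is an *elementary collapse* from a finite simplicial complex $K$ to a subcomplex $L$ if there are a simplex $S$ of $K$ and a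 vertex $a$ of $K$ not in $S$ with $K=L\cup aS$ and $L\cap aS=a\partial S$. A *simplicial expansion* is an injective simplicial map $L\to K$ of finite simplicial complexes such that finitely many (possibly zero) elementary collapses lead from $K$ to the image of $L$. A homotopy equivalence $|K|\to|L|$ between realizations of finite simplicial complexes is a *simple homotopy equivalence* if it is homotopic to the composition of a finite sequence of maps $|K|=|K_0|\to|K_1|\to\dots\to|K_n|=|L|$ between realizations of finite simplicial complexes, each of which is the realization of a simplicial expansion or a homotopy inverse of one. **Theorem.** (a) Let $f:X\to Y$ be a map between finite $T_0$-spaces. Then $f\in\overline{\mathcal D}$ if and only if $|\mathcal K(f)|:|\mathcal K(X)|\to|\mathcal K(Y)|$ is a simple homotopy equivalence. (b) Let $\varphi:K\to L$ be a simplicial map between finite simplicial complexes. Then $|\varphi|:|K|\to|L|$ is a simple homotopy equivalence if and only if $\mathcal X(\varphi)\in\overline{\mathcal D}$. -/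

import Mathlib

universe u

namespace SimpleHomotopy

/-! ### Finite spaces -/

/-- The minimal open set `U_x`: the intersection of all open sets containing `x`. -/
def minOpen {X : Type u} [TopologicalSpace X] (x : X) : Set X :=
  ⋂₀ {U : Set X | IsOpen U ∧ x ∈ U}

/-- A map is distinguished if the preimage of every minimal open set is contractible. -/
def IsDistinguished {X Y : Type u} [TopologicalSpace X] [TopologicalSpace Y] (f : C(X, Y)) :
    Prop :=
  ∀ y : Y, ContractibleSpace (f ⁻¹' minOpen y)

/-- A class of continuous maps between finite T₀-spaces. -/
abbrev MapClass : Type (u + 1) :=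
  ∀ (X Y : Type u) [TopologicalSpace X] [Finite X] [T0Space X]
    [TopologicalSpace Y] [Finite Y] [T0Space Y], C(X, Y) → Prop

/-- The class of distinguished maps between finite T₀-spaces. -/
def distinguishedMaps : MapClass.{u} :=
  fun _ _ _ _ _ _ _ _ f => IsDistinguished f

/-- The class generated by `C`: the smallest class of maps between finite T₀-spaces which contains
`C` and has the 2-out-of-3 property up to homotopy, that is, whenever `f ∘ g ≃ h` and two of
`f`, `g`, `h` are in the class, so is the third. -/
inductive Generated (C : MapClass.{u}) :
    ∀ {X Y : Type u} [TopologicalSpace X] [Finite X] [T0Space X]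
      [TopologicalSpace Y] [Finite Y] [T0Space Y], C(X, Y) → Prop
  | base {X Y : Type u} [TopologicalSpace X] [Finite X] [T0Space X]
      [TopologicalSpace Y] [Finite Y] [T0Space Y] {f : C(X, Y)} :
      C X Y f → Generated C f
  | comp {X Y Z : Type u} [TopologicalSpace X] [Finite X] [T0Space X]
      [TopologicalSpace Y] [Finite Y] [T0Space Y] [TopologicalSpace Z] [Finite Z] [T0Space Z]
      {f : C(Y, Z)} {g : C(X, Y)} {h : C(X, Z)} :
      (f.comp g).Homotopic h → Generated C f → Generated C g → Generated C h
  | left {X Y Z : Type u} [TopologicalSpace X] [Finite X] [T0Space X]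
      [TopologicalSpace Y] [Finite Y] [T0Space Y] [TopologicalSpace Z] [Finite Z] [T0Space Z]
      {f : C(Y, Z)} {g : C(X, Y)} {h : C(X, Z)} :
      (f.comp g).Homotopic h → Generated C g → Generated C h → Generated C f
  | right {X Y Z : Type u} [TopologicalSpace X] [Finite X] [T0Space X]
      [TopologicalSpace Y] [Finite Y] [T0Space Y] [TopologicalSpace Z] [Finite Z] [T0Space Z]
      {f : C(Y, Z)} {g : C(X, Y)} {h : C(X, Z)} :
      (f.comp g).Homotopic h → Generated C f → Generated C h → Generated C g

/-- The class `D̄` generated by the distinguished maps. -/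
def InDBar {X Y : Type u} [TopologicalSpace X] [Finite X] [T0Space X]
    [TopologicalSpace Y] [Finite Y] [T0Space Y] (f : C(X, Y)) : Prop :=
  Generated distinguishedMaps.{u} f

/-! ### Simplicial complexes, simplicial maps, geometric realization -/

open Classical in
/-- A simplicial map: a map of vertices that sends simplices to simplices. -/
structure SimplicialMap {V W : Type u} (K : AbstractSimplicialComplex V)
    (L : AbstractSimplicialComplex W) where
  toFun : V → W
  image_mem : ∀ s ∈ K, s.image toFun ∈ L

/-- The geometric realization `|K|`: functions on the vertices with non-negative values of sum one
(barycentric coordinates) that are supported in a simplex of `K`. It carries the subspace topology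
of the standard simplex. -/
abbrev Realization {V : Type u} [Fintype V] (K : AbstractSimplicialComplex V) : Type u :=
  {x : stdSimplex ℝ V // ∃ s ∈ K, ∀ v, x v ≠ 0 → v ∈ s}

open Classical in
/-- The map `|φ| : |K| → |L|` induced by a simplicial map, affine on each simplex. -/
noncomputable def SimplicialMap.realization {V W : Type u} [Fintype V] [Fintype W]
    {K : AbstractSimplicialComplex V} {L : AbstractSimplicialComplex W} (φ : SimplicialMap K L) :
    C(Realization K, Realization L) where
  toFun x := ⟨stdSimplex.map φ.toFun x.1, by
    obtain ⟨x, s, hs, hx⟩ := x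
    refine ⟨s.image φ.toFun, φ.image_mem s hs, fun w hw => ?_⟩
    rw [stdSimplex.map_coe, FunOnFinite.linearMap_apply_apply] at hw
    obtain ⟨v, hv, hne⟩ := Finset.exists_ne_zero_of_sum_ne_zero hw
    exact Finset.mem_image.2 ⟨v, hx v hne, by simpa using hv⟩⟩
  continuous_toFun :=
    ((stdSimplex.continuous_map φ.toFun).comp continuous_subtype_val).subtype_mk _

/-! ### Simplicial collapses and simple homotopy equivalences -/

/-- The complex of all faces of the simplex with vertex set `s`. -/
def simplex {V : Type u} (s : Finset V) : PreAbstractSimplicialComplex V where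
  faces := {t | t.Nonempty ∧ t ⊆ s}
  isRelLowerSet_faces := fun _ ht => ⟨ht.1, fun _ hb hne => ⟨hne, hb.trans ht.2⟩⟩

open Classical in
/-- The cone with apex `a` over the boundary of the simplex `S`, where `a ∉ S`: the faces of the
simplex `aS` which do not contain `S`. -/
def coneBoundary {V : Type u} (a : V) (S : Finset V) : PreAbstractSimplicialComplex V where
  faces := {t | t.Nonempty ∧ t ⊆ insert a S ∧ ¬ S ⊆ t}
  isRelLowerSet_faces := fun _ ht =>
    ⟨ht.1, fun _ hb hne => ⟨hne, hb.trans ht.2.1, fun h => ht.2.2 (h.trans hb)⟩⟩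

open Classical in
/-- Elementary simplicial collapse of `K` to `L`: for some simplex `S` and vertex `a ∉ S` of `K`,
one has `K = L ∪ aS` and `L ∩ aS = a ∂S`. -/
def ElementaryCollapse {V : Type u} (K L : PreAbstractSimplicialComplex V) : Prop :=
  ∃ S ∈ K, ∃ a : V, {a} ∈ K ∧ a ∉ S ∧
    K = L ⊔ simplex (insert a S) ∧ L ⊓ simplex (insert a S) = coneBoundary a S

/-- `K` collapses to `L` by finitely many elementary collapses. -/
def Collapses {V : Type u} (K L : PreAbstractSimplicialComplex V) : Prop :=
  Relation.ReflTransGen ElementaryCollapse K L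

open Classical in
/-- A simplicial expansion: an injective simplicial map `i : L → K` which identifies `L` with a
subcomplex of `K` to which `K` collapses. -/
def IsExpansion {V W : Type u} {L : AbstractSimplicialComplex V} {K : AbstractSimplicialComplex W}
    (i : SimplicialMap L K) : Prop :=
  Function.Injective i.toFun ∧
    Collapses K.toPreAbstractSimplicialComplex (L.toPreAbstractSimplicialComplex.map i.toFun)

/-- Finite compositions `|K| → |K₁| → ⋯ → |L|` in which each map is a simplicial expansion or a
homotopy inverse of one; all complexes are finite. -/
inductive IsDeformation : ∀ {V W : Type u} [Fintype V] [Fintype W]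
    {K : AbstractSimplicialComplex V} {L : AbstractSimplicialComplex W},
    C(Realization K, Realization L) → Prop
  | refl {V : Type u} [Fintype V] (K : AbstractSimplicialComplex V) :
      IsDeformation (ContinuousMap.id (Realization K))
  | expansion {V W Z : Type u} [Fintype V] [Fintype W] [Fintype Z]
      {K : AbstractSimplicialComplex V} {L : AbstractSimplicialComplex W}
      {M : AbstractSimplicialComplex Z} {f : C(Realization K, Realization L)}
      (i : SimplicialMap L M) :
      IsExpansion i → IsDeformation f → IsDeformation (i.realization.comp f)
  | inverse {V W Z : Type u} [Fintype V] [Fintype W] [Fintype Z]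
      {K : AbstractSimplicialComplex V} {L : AbstractSimplicialComplex W}
      {M : AbstractSimplicialComplex Z} {f : C(Realization K, Realization L)}
      (i : SimplicialMap M L) (r : C(Realization L, Realization M)) :
      IsExpansion i →
      (r.comp i.realization).Homotopic (ContinuousMap.id (Realization M)) →
      (i.realization.comp r).Homotopic (ContinuousMap.id (Realization L)) →
      IsDeformation f → IsDeformation (r.comp f)

/-- A simple homotopy equivalence `|K| → |L|`: a homotopy equivalence which is homotopic to a
finite composition of simplicial expansions and homotopy inverses of such. -/
def IsSimpleHomotopyEquiv {V W : Type u} [Fintype V] [Fintype W]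
    {K : AbstractSimplicialComplex V} {L : AbstractSimplicialComplex W}
    (f : C(Realization K, Realization L)) : Prop :=
  (∃ e : ContinuousMap.HomotopyEquiv (Realization K) (Realization L), e.toFun = f) ∧
    ∃ g : C(Realization K, Realization L), IsDeformation g ∧ f.Homotopic g

/-! ### The functor `K` from finite spaces to simplicial complexes -/

theorem minOpen_map {X Y : Type u} [TopologicalSpace X] [TopologicalSpace Y] (f : C(X, Y))
    {x y : X} (h : x ∈ minOpen y) : f x ∈ minOpen (f y) :=
  fun U hU => h (f ⁻¹' U) ⟨hU.1.preimage f.continuous, hU.2⟩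

/-- The complex `K(X)` of non-empty finite chains of `X`, where `x ≤ y` means `x ∈ U_y`. -/
def orderComplex (X : Type u) [TopologicalSpace X] : AbstractSimplicialComplex X where
  faces := {s | s.Nonempty ∧ IsChain (fun x y => x ∈ minOpen y) (s : Set X)}
  isRelLowerSet_faces := fun _ hs =>
    ⟨hs.1, fun _ hb hne => ⟨hne, hs.2.mono (by exact_mod_cast hb)⟩⟩
  singleton_mem v := ⟨Finset.singleton_nonempty v, by simp [IsChain]⟩

open Classical in
/-- The simplicial map `K(f)`, which coincides with `f` on vertices. -/
def orderComplexMap {X Y : Type u} [TopologicalSpace X] [TopologicalSpace Y] (f : C(X, Y)) :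
    SimplicialMap (orderComplex X) (orderComplex Y) where
  toFun := f
  image_mem := fun s hs => by
    refine ⟨hs.1.image f, ?_⟩
    rw [Finset.coe_image]
    rintro _ ⟨x, hx, rfl⟩ _ ⟨y, hy, rfl⟩ hne
    have hxy : x ≠ y := fun h => hne (congrArg f h)
    exact (hs.2 hx hy hxy).imp (minOpen_map f) (minOpen_map f)

/-! ### The functor `X` from finite simplicial complexes to finite spaces -/

/-- The poset `X(K)` of simplices of `K`, ordered by inclusion. -/
def FaceSpace {V : Type u} (K : AbstractSimplicialComplex V) : Type u :=
  {s : Finset V // s ∈ K}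

instance {V : Type u} (K : AbstractSimplicialComplex V) : PartialOrder (FaceSpace K) :=
  inferInstanceAs (PartialOrder {s : Finset V // s ∈ K})

/-- The topology of the poset `X(K)`, in which the minimal open set of `S` is `{T | T ≤ S}`. -/
instance {V : Type u} (K : AbstractSimplicialComplex V) : TopologicalSpace (FaceSpace K) :=
  Topology.lowerSet (FaceSpace K)

instance {V : Type u} [Finite V] (K : AbstractSimplicialComplex V) : Finite (FaceSpace K) :=
  inferInstanceAs (Finite {s : Finset V // s ∈ K})

theorem minOpen_faceSpace {V : Type u} (K : AbstractSimplicialComplex V) (S : FaceSpace K) :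
    minOpen S = {T : FaceSpace K | T ≤ S} := by
  apply Set.Subset.antisymm
  · exact fun T hT => hT {T | T ≤ S} ⟨fun _ _ hba ha => le_trans hba ha, le_refl S⟩
  · exact fun T hT U hU => hU.1 hT hU.2

instance {V : Type u} (K : AbstractSimplicialComplex V) : T0Space (FaceSpace K) where
  t0 := fun S T h => by
    have key : ∀ A B : FaceSpace K, Inseparable A B → A ≤ B := fun A B hAB =>
      (hAB.mem_open_iff (s := {C : FaceSpace K | C ≤ B})
        (fun _ _ hba ha => le_trans hba ha)).2 (le_refl B)
    exact le_antisymm (key S T h) (key T S h.symm)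

open Classical in
/-- The continuous map `X(φ)`, `S ↦ φ(S)`. -/
noncomputable def faceSpaceMap {V W : Type u} {K : AbstractSimplicialComplex V}
    {L : AbstractSimplicialComplex W} (φ : SimplicialMap K L) :
    C(FaceSpace K, FaceSpace L) where
  toFun S := ⟨S.1.image φ.toFun, φ.image_mem S.1 S.2⟩
  continuous_toFun := ⟨fun _ hU _ _ hba ha => hU (Finset.image_subset_image hba) ha⟩

end SimpleHomotopy

open Topology unitInterval

namespace SimpleHomotopy

/-! ### Finite spaces and the specialization order -/

section FiniteSpaces

variable {X Y Z : Type u} [TopologicalSpace X] [TopologicalSpace Y] [TopologicalSpace Z]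

/-! The order `x ≤ y` is the specialization relation `x ⤳ y`, and the proof compares two classes of
maps that both satisfy 2-out-of-3 up to homotopy.

From `D̄` to simple homotopy equivalences, 2-out-of-3 and the homotopy invariance of `K`
(`orderComplexMap_homotopic`) reduce everything to one distinguished map `f`. The order complex of
its mapping cylinder collapses to the codomain for every `f`. It collapses to the domain when `f` is
distinguished: removing a point `y` of the codomain leaves the link `f⁻¹(U_y) * Y_{>y}`, and the
contractible factor can be dismantled point by point (`dismantlable_of_contractibleSpace`,
`collapses_cliqueComplex_diff`). For a simplicial map `φ`, the maps `K(X(φ))` and `φ` are conjugate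
up to homotopy by the subdivision maps, which are simple homotopy equivalences by a second cylinder
argument.

From simple homotopy equivalences to `D̄`, an elementary collapse induces an inclusion of face
posets in `D̄`, hence so does every expansion (`IsExpansion.inDBar`). The deformation may pass
through maps that are not simplicial, so simplicial approximation is needed. Approximations exist
after precomposition with a subdivision map in `D̄` (`exists_approximation`), and membership of
`X(φ)` in `D̄` depends only on the homotopy class of `|φ|` (`inDBar_of_homotopic`). A deformation
`|K| → |L|` thus becomes a roof `K ← M → L` of simplicial maps with both legs in `D̄`
(`IsDeformation.exists_roof`), and 2-out-of-3 gives (b). Part (a) follows from (b) because `chainMax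
: X(K(X)) → X` is distinguished and natural up to homotopy. -/

theorem mem_minOpen_iff {x y : X} : x ∈ minOpen y ↔ x ⤳ y := by
  rw [specializes_iff_forall_open]
  exact ⟨fun h s hs hy => h s ⟨hs, hy⟩, fun h s hs => h s hs.1 hs.2⟩

theorem FaceSpace.specializes_iff {V : Type u} {K : AbstractSimplicialComplex V}
    {S T : FaceSpace K} : S ⤳ T ↔ S.1 ⊆ T.1 := by
  rw [← mem_minOpen_iff, minOpen_faceSpace]
  exact Iff.rfl

theorem continuous_of_specializes [AlexandrovDiscrete X] {f : X → Y}
    (h : ∀ x y, x ⤳ y → f x ⤳ f y) : Continuous f := by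
  refine ⟨fun s hs => isOpen_iff_forall_specializes.2 fun x y hxy hy => ?_⟩
  exact (h x y hxy).mem_open hs hy

theorem subtype_specializes_iff {p : X → Prop} {x y : Subtype p} : x ⤳ y ↔ x.1 ⤳ y.1 :=
  (IsInducing.subtypeVal.specializes_iff).symm

/-- The homotopy is `f` for all times `t < 1` and jumps to `g` at `t = 1`. It is continuous because
`f ≤ g` gives `g⁻¹(U) ⊆ f⁻¹(U)` for open `U`. -/
theorem homotopic_of_specializes {f g : C(X, Y)} (h : ∀ x, f x ⤳ g x) : f.Homotopic g := by
  classical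
  refine ⟨⟨⟨fun p => if p.1 = 1 then g p.2 else f p.2, ⟨fun U hU => ?_⟩⟩,
    fun x => by simp, fun x => by simp⟩⟩
  have : (fun p : I × X => if p.1 = 1 then g p.2 else f p.2) ⁻¹' U =
      ({1}ᶜ ×ˢ (f ⁻¹' U)) ∪ (Set.univ ×ˢ (g ⁻¹' U)) := by
    ext ⟨t, x⟩
    by_cases ht : t = 1
    · simp [ht]
    · simpa [ht] using fun hx => (h x).mem_open hU hx
  rw [this]
  exact (isOpen_compl_singleton.prod (hU.preimage f.continuous)).union
    (isOpen_univ.prod (hU.preimage g.continuous))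

/-- Homotopic maps between finite spaces are joined by a fence of comparable maps. -/
theorem eqvGen_of_homotopic [Finite X] [Finite Y] {f g : C(X, Y)} (h : f.Homotopic g) :
    Relation.EqvGen (fun f g : C(X, Y) => ∀ x, f x ⤳ g x) f g := by
  obtain ⟨H⟩ := h
  let q : I → Quot (fun f g : C(X, Y) => ∀ x, f x ⤳ g x) := fun t => Quot.mk _ (H.curry t)
  have hq : IsLocallyConstant q := by
    rw [IsLocallyConstant.iff_eventually_eq]
    intro t
    -- For `s` near `t`, the point `H (s, x)` stays in the minimal open set of `H (t, x)`;
    -- finiteness of `X` gives one neighbourhood for all `x`. The fence class of `H (t, ·)` is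
    -- therefore locally constant on the connected interval.
    have : ∀ᶠ s in 𝓝 t, ∀ x, H (s, x) ⤳ H (t, x) := by
      rw [Filter.eventually_all]
      intro x
      have hc : Continuous fun s : I => H (s, x) := by fun_prop
      have ho : IsOpen {y : Y | y ⤳ H (t, x)} :=
        isOpen_iff_forall_specializes.2 fun a b hab hb => hab.trans hb
      exact hc.continuousAt.eventually (ho.mem_nhds specializes_rfl)
    exact this.mono fun s hs => Quot.sound fun x => hs x
  have h01 := hq.apply_eq_of_preconnectedSpace 0 1
  have := Quot.eqvGen_exact h01
  simpa using this

theorem contractibleSpace_of_forall_specializes (m : X) (h : ∀ x, x ⤳ m) :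
    ContractibleSpace X :=
  (contractible_iff_id_nullhomotopic X).2 ⟨m, homotopic_of_specializes h⟩

/-- A space with a map `g ≥ id` with `g ≥ m` is contractible. -/
theorem contractibleSpace_of_fence (g : C(X, X)) (m : X) (h : ∀ x, x ⤳ g x)
    (hm : ∀ x, m ⤳ g x) : ContractibleSpace X :=
  (contractible_iff_id_nullhomotopic X).2 ⟨m, (homotopic_of_specializes (g := g) h).trans
    (homotopic_of_specializes (f := ContinuousMap.const X m) hm).symm⟩

/-- The point `r y` is the maximum of `f⁻¹(U_y)`, and a finite or infinite space with a maximum is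
contractible. Monotonicity of `r` is not needed separately. -/
theorem isDistinguished_of_adjoint {f : C(X, Y)} (r : Y → X)
    (h : ∀ x y, f x ⤳ y ↔ x ⤳ r y) : IsDistinguished f := fun y => by
  refine contractibleSpace_of_forall_specializes (X := f ⁻¹' minOpen y)
    ⟨r y, mem_minOpen_iff.2 ((h _ _).2 specializes_rfl)⟩ fun x => ?_
  rw [subtype_specializes_iff]
  exact (h _ _).1 (mem_minOpen_iff.1 x.2)

theorem isDistinguished_iff {f : C(X, Y)} :
    IsDistinguished f ↔ ∀ y, ContractibleSpace {x // f x ⤳ y} := by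
  refine forall_congr' fun y => (Homeomorph.contractibleSpace_iff ?_)
  exact (Homeomorph.refl X).subtype fun x => mem_minOpen_iff

end FiniteSpaces

/-! ### Closure properties of the class generated by distinguished maps -/

section Closure

variable {X Y Z : Type u} [TopologicalSpace X] [Finite X] [T0Space X]
  [TopologicalSpace Y] [Finite Y] [T0Space Y] [TopologicalSpace Z] [Finite Z] [T0Space Z]

theorem InDBar.of_isDistinguished {f : C(X, Y)} (h : IsDistinguished f) : InDBar f :=
  Generated.base h

theorem InDBar.of_adjoint {f : C(X, Y)} (r : Y → X) (h : ∀ x y, f x ⤳ y ↔ x ⤳ r y) :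
    InDBar f :=
  .of_isDistinguished (isDistinguished_of_adjoint r h)

theorem InDBar.id : InDBar (ContinuousMap.id X) :=
  .of_adjoint (fun x => x) fun _ _ => Iff.rfl

theorem InDBar.comp {f : C(Y, Z)} {g : C(X, Y)} (hf : InDBar f) (hg : InDBar g) :
    InDBar (f.comp g) :=
  Generated.comp (.refl _) hf hg

theorem InDBar.congr {f g : C(X, Y)} (h : f.Homotopic g) (hf : InDBar f) : InDBar g :=
  Generated.comp (f := f) (g := ContinuousMap.id X) (by simpa using h) hf InDBar.id

theorem InDBar.of_comp_left {f : C(Y, Z)} {g : C(X, Y)} (hg : InDBar g)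
    (h : InDBar (f.comp g)) : InDBar f :=
  Generated.left (.refl _) hg h

theorem InDBar.of_comp_right {f : C(Y, Z)} {g : C(X, Y)} (hf : InDBar f)
    (h : InDBar (f.comp g)) : InDBar g :=
  Generated.right (.refl _) hf h

end Closure

/-! ### Geometric realizations -/

section Realization

variable {V W Z : Type u} [Fintype V] [Fintype W] [Fintype Z]
  {K : AbstractSimplicialComplex V} {L : AbstractSimplicialComplex W}
  {M : AbstractSimplicialComplex Z} {A : Type*} [TopologicalSpace A]

theorem face_nonempty {V : Type u} {K : AbstractSimplicialComplex V} {s : Finset V} (h : s ∈ K) :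
    s.Nonempty :=
  (K.isRelLowerSet_faces h).1

theorem face_of_subset {V : Type u} {K : AbstractSimplicialComplex V} {s t : Finset V} (h : s ∈ K)
    (hts : t ⊆ s) (ht : t.Nonempty) : t ∈ K :=
  (K.isRelLowerSet_faces h).2 hts ht

/-- The point `x` of `|K|` lies in the simplex `s`. -/
def Carried (x : Realization K) (s : Finset V) : Prop :=
  ∀ v, x.1 v ≠ 0 → v ∈ s

theorem Carried.mono {x : Realization K} {s t : Finset V} (h : Carried x s) (hst : s ⊆ t) :
    Carried x t :=
  fun v hv => hst (h v hv)

theorem exists_carried (x : Realization K) : ∃ s ∈ K, Carried x s := x.2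

theorem realization_ext {x y : Realization K} (h : ∀ v, x.1 v = y.1 v) : x = y :=
  Subtype.ext (stdSimplex.ext (funext h))

theorem realization_nonneg (x : Realization K) (v : V) : 0 ≤ x.1 v := stdSimplex.zero_le x.1 v

theorem realization_sum (x : Realization K) : ∑ v, x.1 v = 1 := stdSimplex.sum_eq_one x.1

theorem continuous_coord (v : V) : Continuous fun x : Realization K => x.1 v :=
  (continuous_apply v).comp (continuous_subtype_val.comp continuous_subtype_val)

/-- Maps to a realization given by coordinates. -/
def ofCoords (F : A → V → ℝ) (hF : ∀ v, Continuous fun a => F a v) (h0 : ∀ a v, 0 ≤ F a v)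
    (h1 : ∀ a, ∑ v, F a v = 1) (hs : ∀ a, ∃ s ∈ K, ∀ v, F a v ≠ 0 → v ∈ s) :
    C(A, Realization K) where
  toFun a := ⟨⟨F a, h0 a, h1 a⟩, hs a⟩
  continuous_toFun := ((continuous_pi hF).subtype_mk _).subtype_mk _

theorem ofCoords_apply (F : A → V → ℝ) (hF : ∀ v, Continuous fun a => F a v)
    (h0 : ∀ a v, 0 ≤ F a v) (h1 : ∀ a, ∑ v, F a v = 1)
    (hs : ∀ a, ∃ s ∈ K, ∀ v, F a v ≠ 0 → v ∈ s) (a : A) (v : V) :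
    (ofCoords F hF h0 h1 hs a).1 v = F a v := rfl

/-- Two maps which carry each point into a common simplex are homotopic. -/
theorem homotopic_of_carried {f g : C(A, Realization K)}
    (h : ∀ a, ∃ s ∈ K, Carried (f a) s ∧ Carried (g a) s) : f.Homotopic g := by
  refine ⟨⟨ofCoords (A := I × A)
    (fun p v => (1 - (p.1 : ℝ)) * (f p.2).1 v + (p.1 : ℝ) * (g p.2).1 v)
    (fun v => ?_) (fun p v => ?_) (fun p => ?_) (fun p => ?_), fun a => ?_, fun a => ?_⟩⟩
  · have h1 := (continuous_coord (K := K) v).comp (f.continuous.comp (continuous_snd (X := I)))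
    have h2 := (continuous_coord (K := K) v).comp (g.continuous.comp (continuous_snd (X := I)))
    have h3 : Continuous fun p : I × A => (p.1 : ℝ) := by fun_prop
    exact ((continuous_const.sub h3).mul h1).add (h3.mul h2)
  · exact add_nonneg (mul_nonneg (sub_nonneg.2 p.1.2.2) (realization_nonneg _ _))
      (mul_nonneg p.1.2.1 (realization_nonneg _ _))
  · rw [Finset.sum_add_distrib, ← Finset.mul_sum, ← Finset.mul_sum, realization_sum,
      realization_sum]
    ring
  · obtain ⟨s, hs, hf, hg⟩ := h p.2
    refine ⟨s, hs, fun v hv => ?_⟩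
    by_contra hvs
    have h1 : (f p.2).1 v = 0 := by_contra fun h => hvs (hf v h)
    have h2 : (g p.2).1 v = 0 := by_contra fun h => hvs (hg v h)
    simp [h1, h2] at hv
  · exact realization_ext fun v => by simp [ofCoords_apply]
  · exact realization_ext fun v => by simp [ofCoords_apply]

open Classical in
theorem realization_apply (φ : SimplicialMap K L) (x : Realization K) (w : W) :
    (φ.realization x).1 w = ∑ v with φ.toFun v = w, x.1 v := by
  change (stdSimplex.map φ.toFun x.1) w = _
  rw [stdSimplex.map_coe, FunOnFinite.linearMap_apply_apply]

theorem carried_realization (φ : SimplicialMap K L) {x : Realization K} {s : Finset V}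
    {t : Finset W} (hx : Carried x s) (hst : ∀ v ∈ s, φ.toFun v ∈ t) :
    Carried (φ.realization x) t := by
  classical
  intro w hw
  rw [realization_apply] at hw
  obtain ⟨v, hv, hne⟩ := Finset.exists_ne_zero_of_sum_ne_zero hw
  rw [← (Finset.mem_filter.1 hv).2]
  exact hst v (hx v hne)

/-- The identity simplicial map. -/
def SimplicialMap.id {V : Type u} (K : AbstractSimplicialComplex V) : SimplicialMap K K where
  toFun v := v
  image_mem s hs := by simpa using hs

open Classical in
/-- Composition of simplicial maps. -/
def SimplicialMap.comp {V W Z : Type u} {K : AbstractSimplicialComplex V}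
    {L : AbstractSimplicialComplex W} {M : AbstractSimplicialComplex Z}
    (ψ : SimplicialMap L M) (φ : SimplicialMap K L) : SimplicialMap K M where
  toFun v := ψ.toFun (φ.toFun v)
  image_mem s hs := by
    have := ψ.image_mem _ (φ.image_mem s hs)
    rwa [Finset.image_image] at this

theorem realization_id : (SimplicialMap.id K).realization = ContinuousMap.id (Realization K) := by
  ext1 x
  exact Subtype.ext (stdSimplex.map_id_apply x.1)

theorem realization_comp (ψ : SimplicialMap L M) (φ : SimplicialMap K L) :
    (ψ.comp φ).realization = ψ.realization.comp φ.realization := by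
  ext1 x
  exact Subtype.ext (stdSimplex.map_comp_apply φ.toFun ψ.toFun x.1).symm

theorem SimplicialMap.ext {V W : Type u} {K : AbstractSimplicialComplex V}
    {L : AbstractSimplicialComplex W} {φ ψ : SimplicialMap K L}
    (h : ∀ v, φ.toFun v = ψ.toFun v) : φ = ψ := by
  cases φ; cases ψ
  congr
  exact funext h

open Classical in
/-- Contiguous simplicial maps. -/
def Contiguous {V W : Type u} {K : AbstractSimplicialComplex V}
    {L : AbstractSimplicialComplex W} (φ ψ : SimplicialMap K L) : Prop :=
  ∀ s ∈ K, s.image φ.toFun ∪ s.image ψ.toFun ∈ L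

theorem Contiguous.homotopic {φ ψ : SimplicialMap K L} (h : Contiguous φ ψ) :
    φ.realization.Homotopic ψ.realization := by
  classical
  refine homotopic_of_carried fun x => ?_
  obtain ⟨s, hs, hx⟩ := exists_carried x
  refine ⟨_, h s hs, carried_realization φ hx fun v hv => ?_, carried_realization ψ hx fun v hv => ?_⟩
  · exact Finset.mem_union_left _ (Finset.mem_image_of_mem _ hv)
  · exact Finset.mem_union_right _ (Finset.mem_image_of_mem _ hv)

/-- The realization is a finite union of closed faces of the standard simplex. Compactness supplies
the Lebesgue number in simplicial approximation. -/
instance : CompactSpace (Realization K) := by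
  suffices IsClosed {x : stdSimplex ℝ V | ∃ s ∈ K, ∀ v, x v ≠ 0 → v ∈ s} from
    isCompact_iff_compactSpace.1 this.isCompact
  have : {x : stdSimplex ℝ V | ∃ s ∈ K, ∀ v, x v ≠ 0 → v ∈ s} =
      ⋃ s ∈ (K : Set (Finset V)), ⋂ v ∈ {v | v ∉ s}, {x : stdSimplex ℝ V | x v = 0} := by
    ext x
    simp only [Set.mem_ofPred_eq, Set.mem_iUnion, Set.mem_iInter, SetLike.mem_coe, exists_prop]
    exact exists_congr fun s => and_congr_right fun _ => forall_congr' fun v => not_imp_comm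
  rw [this]
  refine (Set.toFinite _).isClosed_biUnion fun s _ => isClosed_biInter fun v _ => ?_
  exact isClosed_eq ((continuous_apply v).comp continuous_subtype_val) continuous_const

open Classical in
/-- A vertex as a point of the realization. -/
noncomputable def vertexPoint (K : AbstractSimplicialComplex V) (v : V) : Realization K :=
  ⟨stdSimplex.vertex v, {v}, K.singleton_mem v, fun w hw => by
    by_contra h
    simp only [Finset.mem_singleton] at h
    exact hw (by simp [h])⟩

open Classical in
/-- The barycenter of a simplex, or any point in its interior. -/
theorem exists_interior_point {s : Finset V} (hs : s ∈ K) :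
    ∃ x : Realization K, Carried x s ∧ ∀ v ∈ s, x.1 v ≠ 0 := by
  have hc : (s.card : ℝ) ≠ 0 := by simpa using (face_nonempty hs).ne_empty
  refine ⟨⟨⟨fun v => if v ∈ s then (s.card : ℝ)⁻¹ else 0, fun v => ?_, ?_⟩, s, hs, fun v hv => ?_⟩,
    fun v hv => ?_, fun v hv => ?_⟩
  · dsimp only
    split_ifs <;> positivity
  · simp [Finset.sum_ite_mem, hc]
  · by_contra h
    exact hv (if_neg h)
  · by_contra h
    exact hv (if_neg h)
  · change (if v ∈ s then (s.card : ℝ)⁻¹ else 0) ≠ 0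
    simpa [hv] using hc

end Realization

/-! ### Collapses and simple homotopy equivalences -/

section Collapse

variable {V W Z : Type u}

open Classical in
-- In terms of membership, an elementary collapse removes exactly the two simplices `S` and `aS`.
theorem elementaryCollapse_data {P Q : PreAbstractSimplicialComplex V}
    (h : ElementaryCollapse P Q) : ∃ (S : Finset V) (a : V), S.Nonempty ∧ a ∉ S ∧
      (∀ t ∈ Q, t ∈ P) ∧ insert a S ∈ P ∧ S ∈ P ∧ (∀ t ∈ P, t ∈ Q ∨ t ⊆ insert a S) ∧
      (∀ t ∈ Q, ¬ S ⊆ t) ∧ ∀ t : Finset V, t.Nonempty → t ⊆ insert a S → ¬ S ⊆ t → t ∈ Q := by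
  obtain ⟨S, hS, a, -, haS, hP, hQ⟩ := h
  have hSn : S.Nonempty := (P.isRelLowerSet_faces hS).1
  have hmem : ∀ t, t ∈ P ↔ t ∈ Q ∨ (t.Nonempty ∧ t ⊆ insert a S) := fun t => by
    rw [hP]; exact Iff.rfl
  have hmem' : ∀ t, (t ∈ Q ∧ t.Nonempty ∧ t ⊆ insert a S) ↔
      (t.Nonempty ∧ t ⊆ insert a S ∧ ¬ S ⊆ t) := fun t => by
    have : t ∈ Q ⊓ simplex (insert a S) ↔ t ∈ coneBoundary a S := by rw [hQ]
    exact this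
  refine ⟨S, a, hSn, haS, fun t ht => (hmem t).2 (.inl ht),
    (hmem _).2 (.inr ⟨Finset.insert_nonempty _ _, subset_rfl⟩), hS,
    fun t ht => ((hmem t).1 ht).imp_right And.right, fun t ht hSt => ?_,
    fun t h1 h2 h3 => ((hmem' t).2 ⟨h1, h2, h3⟩).1⟩
  have hSQ : S ∈ Q := (Q.isRelLowerSet_faces ht).2 hSt hSn
  exact ((hmem' S).1 ⟨hSQ, hSn, Finset.subset_insert _ _⟩).2.2 subset_rfl

theorem collapses_le {P Q : PreAbstractSimplicialComplex V} (h : Collapses P Q) :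
    ∀ t ∈ Q, t ∈ P := by
  induction h with
  | refl => exact fun _ h => h
  | tail _ h ih =>
    obtain ⟨S, a, -, -, hle, -⟩ := elementaryCollapse_data h
    exact fun t ht => ih t (hle t ht)

variable [Fintype V] [Fintype W] [Fintype Z]
  {K : AbstractSimplicialComplex V} {L : AbstractSimplicialComplex W}
  {M : AbstractSimplicialComplex Z}

/-- A collapse of `K` yields a retraction of `|K|` which is homotopic to the identity. -/
theorem exists_retraction {Q : PreAbstractSimplicialComplex V}
    (h : Collapses K.toPreAbstractSimplicialComplex Q) :
    ∃ r : C(Realization K, Realization K), r.Homotopic (ContinuousMap.id _) ∧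
      (∀ x, ∃ s ∈ Q, Carried (r x) s) ∧ ∀ x, ∀ s ∈ Q, Carried x s → r x = x := by
  classical
  induction h with
  | refl => exact ⟨ContinuousMap.id _, .refl _, fun x => exists_carried x, fun _ _ _ _ => rfl⟩
  | @tail P Q hKP h ih =>
    obtain ⟨r, hr, hrP, hrx⟩ := ih
    have hPK := collapses_le hKP
    obtain ⟨S, a, hSn, haS, hle, haP, -, hPQ, hQS, hSQ⟩ := elementaryCollapse_data h
    let m : Realization K → ℝ := fun x => S.inf' hSn fun v => x.1 v
    have hm : Continuous m := Continuous.finset_inf'_apply hSn fun v _ => continuous_coord v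
    have hm0 : ∀ x, 0 ≤ m x := fun x => Finset.le_inf' _ _ fun v _ => realization_nonneg x v
    have hmle : ∀ x, ∀ v ∈ S, m x ≤ x.1 v := fun x v hv => Finset.inf'_le _ hv
    -- With `m x` the least coordinate on `S`, take the amount `m x` from every vertex of `S` and
    -- give the total to `a`. Some coordinate on `S` becomes zero, so `aS` is pushed onto `a ∂S`.
    -- Where `m` vanishes, in particular on `Q`, nothing moves.
    let F : Realization K → V → ℝ := fun x v =>
      x.1 v + m x * ((if v = a then (S.card : ℝ) else 0) - if v ∈ S then 1 else 0)
    have hFQ : ∀ x t, t ∈ Q → Carried x t → ∀ v, F x v = x.1 v := by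
      intro x t ht hx v
      obtain ⟨w, hw, hwt⟩ := Finset.not_subset.1 (hQS t ht)
      have h0 : x.1 w = 0 := by_contra fun h => hwt (hx w h)
      have : m x = 0 := le_antisymm (h0 ▸ hmle x w hw) (hm0 x)
      simp [F, this]
    have hF0 : ∀ x, m x = 0 ∨ ∃ v ∈ S, F x v = 0 := by
      intro x
      obtain ⟨v, hv, hvm⟩ := Finset.exists_mem_eq_inf' hSn fun v => x.1 v
      refine .inr ⟨v, hv, ?_⟩
      have hva : v ≠ a := fun h => haS (h ▸ hv)
      have : m x = x.1 v := hvm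
      simp [F, hva, hv, this]
    -- Besides landing in `Q`, the pushed point shares a simplex of `P` with `x`; this makes the
    -- straight-line homotopy available.
    have hcar : ∀ x, (∃ t ∈ P, Carried x t) →
        ∃ s ∈ Q, (∀ v, F x v ≠ 0 → v ∈ s) ∧ ∃ t ∈ P, Carried x t ∧ s ⊆ t := by
      rintro x ⟨t, ht, hx⟩
      rcases hPQ t ht with hQ | hta
      · exact ⟨t, hQ, fun v hv => hx v (by rwa [hFQ x t hQ hx v] at hv), t, ht, hx, subset_rfl⟩
      · have hsum : ∑ v, F x v = 1 := by
          simp [F, Finset.sum_add_distrib, ← Finset.mul_sum]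
        obtain ⟨v₀, -, hv₀⟩ := Finset.exists_ne_zero_of_sum_ne_zero (hsum ▸ one_ne_zero)
        refine ⟨Finset.univ.filter fun v => F x v ≠ 0, hSQ _ ⟨v₀, by simpa using hv₀⟩ ?_ ?_,
          fun v hv => by simpa using hv, insert a S, haP, hx.mono hta, ?_⟩
        · intro v hv
          by_contra hva
          have h1 : x.1 v = 0 := by_contra fun h => hva (hta (hx v h))
          have h2 : v ≠ a ∧ v ∉ S := by simpa using hva
          simp [F, h1, h2] at hv
        · intro hS
          rcases hF0 x with h0 | ⟨v, hv, hv0⟩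
          · obtain ⟨v, hv, hvm⟩ := Finset.exists_mem_eq_inf' hSn fun v => x.1 v
            have hva : v ≠ a := fun h => haS (h ▸ hv)
            have h3 : m x = x.1 v := hvm
            have := hS hv
            simp [F, hva, hv, h3] at this
          · simpa [hv0] using hS hv
        · intro v hv
          by_contra hva
          have h1 : x.1 v = 0 := by_contra fun h => hva (hta (hx v h))
          have h2 : v ≠ a ∧ v ∉ S := by simpa using hva
          simp [F, h1, h2] at hv
    let r' : C(Realization K, Realization K) := ofCoords (fun x => F (r x))
      (fun v => by
        have h1 := (continuous_coord v).comp r.continuous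
        have h2 := hm.comp r.continuous
        exact h1.add (h2.mul continuous_const))
      (fun x v => by
        by_cases hv : v ∈ S
        · have hva : v ≠ a := fun h => haS (h ▸ hv)
          simpa [F, hv, hva] using hmle (r x) v hv
        · have := realization_nonneg (r x) v
          have := hm0 (r x)
          simp only [F, hv, if_false, sub_zero]
          positivity)
      (fun x => by simp [F, Finset.sum_add_distrib, ← Finset.mul_sum])
      (fun x => by
        obtain ⟨s, hs, hF, -⟩ := hcar _ (hrP x)
        exact ⟨s, hPK s (hle s hs), hF⟩)
    refine ⟨r', .trans (homotopic_of_carried fun x => ?_) hr, fun x => ?_,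
      fun x s hs hx => ?_⟩
    · obtain ⟨s, hs, hF, t, ht, hx, hst⟩ := hcar _ (hrP x)
      exact ⟨t, hPK t ht, fun v hv => hst (hF v hv), hx⟩
    · obtain ⟨s, hs, hF, -⟩ := hcar _ (hrP x)
      exact ⟨s, hs, hF⟩
    · refine realization_ext fun v => ?_
      change F (r x) v = x.1 v
      rw [hrx x s (hle s hs) hx, hFQ x s hs hx]

/-- The inverse reads off the barycentric coordinates of the retraction at the vertices `i v`; they
sum to one because the retraction lands in the image of `L` and `i` is injective. -/
theorem IsExpansion.exists_inverse {i : SimplicialMap L K} (hi : IsExpansion i) :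
    ∃ r : C(Realization K, Realization L),
      (r.comp i.realization).Homotopic (ContinuousMap.id (Realization L)) ∧
      (i.realization.comp r).Homotopic (ContinuousMap.id (Realization K)) := by
  classical
  obtain ⟨r, hr, hrL, hrx⟩ := exists_retraction hi.2
  have hrL' : ∀ x, ∃ t ∈ L, Carried (r x) (t.image i.toFun) := fun x => by
    obtain ⟨_, ⟨t, ht, rfl⟩, hx⟩ := hrL x
    exact ⟨t, ht, by convert hx⟩
  have hL : ∀ (x) (t : Finset W), Carried (r x) (t.image i.toFun) → ∀ v, (r x).1 (i.toFun v) ≠ 0 → v ∈ t := by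
    intro x t hx v hv
    obtain ⟨w, hw, hwv⟩ := Finset.mem_image.1 (hx _ hv)
    exact hi.1 hwv ▸ hw
  let s : C(Realization K, Realization L) := ofCoords (fun x v => (r x).1 (i.toFun v))
    (fun v => (continuous_coord _).comp r.continuous) (fun x v => realization_nonneg _ _)
    (fun x => by
      rw [← realization_sum (r x)]
      refine Fintype.sum_of_injective i.toFun hi.1 _ _ (fun w hw => ?_) fun _ => rfl
      obtain ⟨t, ht, hx⟩ := hrL' x
      by_contra h
      obtain ⟨v, -, hv⟩ := Finset.mem_image.1 (hx w h)
      exact hw ⟨v, hv⟩)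
    (fun x => by
      obtain ⟨t, ht, hx⟩ := hrL' x
      exact ⟨t, ht, hL x t hx⟩)
  have his : (i.realization.comp s).Homotopic r := by
    refine homotopic_of_carried fun x => ?_
    obtain ⟨t, ht, hx⟩ := hrL' x
    refine ⟨_, i.image_mem t ht, carried_realization i (s := t) ?_ ?_, by convert hx⟩
    · exact hL x t hx
    · exact fun v hv => Finset.mem_image_of_mem _ hv
  refine ⟨s, homotopic_of_carried fun y => ?_, his.trans hr⟩
  obtain ⟨t, ht, hy⟩ := exists_carried y
  have hiy : Carried (i.realization y) (t.image i.toFun) :=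
    carried_realization i hy fun v hv => Finset.mem_image_of_mem _ hv
  refine ⟨t, ht, hL _ t ?_, hy⟩
  rw [hrx _ (t.image i.toFun) ⟨t, ht, by congr!⟩ hiy]
  exact hiy

theorem IsDeformation.comp {f : C(Realization K, Realization L)}
    {g : C(Realization L, Realization M)} (hf : IsDeformation f) (hg : IsDeformation g) :
    IsDeformation (g.comp f) := by
  induction hg with
  | refl => exact hf
  | expansion i hi _ ih =>
    rw [ContinuousMap.comp_assoc]
    exact .expansion i hi (ih hf)
  | inverse i r hi h1 h2 _ ih =>
    rw [ContinuousMap.comp_assoc]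
    exact .inverse i r hi h1 h2 (ih hf)

theorem IsDeformation.of_expansion {i : SimplicialMap K L} (hi : IsExpansion i) :
    IsDeformation i.realization := by
  have := IsDeformation.expansion i hi (.refl K)
  rwa [ContinuousMap.comp_id] at this

/-- Conjugating homotopies: a composite of maps with homotopy inverses has a homotopy inverse. -/
theorem homotopic_comp_id {A B C : Type*} [TopologicalSpace A] [TopologicalSpace B]
    [TopologicalSpace C] {f : C(A, B)} {f' : C(B, A)} {g : C(B, C)} {g' : C(C, B)}
    (hf : (f'.comp f).Homotopic (.id A)) (hg : (g'.comp g).Homotopic (.id B)) :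
    ((f'.comp g').comp (g.comp f)).Homotopic (.id A) := by
  have h := ContinuousMap.Homotopic.comp (.refl f')
    (ContinuousMap.Homotopic.comp hg (.refl f))
  exact h.trans hf

/-- Reverse the sequence and exchange expansions with their homotopy inverses. -/
theorem IsDeformation.exists_inverse {f : C(Realization K, Realization L)}
    (hf : IsDeformation f) : ∃ g : C(Realization L, Realization K), IsDeformation g ∧
      (g.comp f).Homotopic (.id _) ∧ (f.comp g).Homotopic (.id _) := by
  induction hf with
  | refl K => exact ⟨.id _, .refl K, .refl _, .refl _⟩
  | expansion i hi _ ih =>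
    obtain ⟨g, hg, h1, h2⟩ := ih
    obtain ⟨r, h3, h4⟩ := hi.exists_inverse
    have hr := IsDeformation.inverse i r hi h3 h4 (.refl _)
    rw [ContinuousMap.comp_id] at hr
    exact ⟨g.comp r, hr.comp hg,
      homotopic_comp_id h1 h3, homotopic_comp_id h4 h2⟩
  | inverse i r hi h3 h4 _ ih =>
    obtain ⟨g, hg, h1, h2⟩ := ih
    exact ⟨g.comp i.realization, (IsDeformation.of_expansion hi).comp hg,
      homotopic_comp_id h1 h4, homotopic_comp_id h3 h2⟩

theorem IsDeformation.isSimpleHomotopyEquiv {f : C(Realization K, Realization L)}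
    (hf : IsDeformation f) : IsSimpleHomotopyEquiv f := by
  obtain ⟨g, -, h1, h2⟩ := hf.exists_inverse
  exact ⟨⟨⟨f, g, h1, h2⟩, rfl⟩, f, hf, .refl f⟩

/-- Deformations are invertible up to homotopy, so the homotopy equivalence required by the
definition comes for free. -/
theorem isSimpleHomotopyEquiv_iff {f : C(Realization K, Realization L)} :
    IsSimpleHomotopyEquiv f ↔ ∃ g, IsDeformation g ∧ f.Homotopic g := by
  refine ⟨fun h => h.2, fun ⟨g, hg, hfg⟩ => ?_⟩
  obtain ⟨g', -, h1, h2⟩ := hg.exists_inverse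
  exact ⟨⟨⟨f, g', (ContinuousMap.Homotopic.comp (.refl g') hfg).trans h1,
    (ContinuousMap.Homotopic.comp hfg (.refl g')).trans h2⟩, rfl⟩, g, hg, hfg⟩

namespace IsSimpleHomotopyEquiv

theorem congr {f g : C(Realization K, Realization L)} (h : f.Homotopic g)
    (hf : IsSimpleHomotopyEquiv f) : IsSimpleHomotopyEquiv g := by
  obtain ⟨d, hd, hfd⟩ := isSimpleHomotopyEquiv_iff.1 hf
  exact isSimpleHomotopyEquiv_iff.2 ⟨d, hd, h.symm.trans hfd⟩

theorem comp {f : C(Realization L, Realization M)} {g : C(Realization K, Realization L)}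
    (hf : IsSimpleHomotopyEquiv f) (hg : IsSimpleHomotopyEquiv g) :
    IsSimpleHomotopyEquiv (f.comp g) := by
  obtain ⟨d, hd, hfd⟩ := isSimpleHomotopyEquiv_iff.1 hf
  obtain ⟨e, he, hge⟩ := isSimpleHomotopyEquiv_iff.1 hg
  exact isSimpleHomotopyEquiv_iff.2 ⟨d.comp e, he.comp hd, hfd.comp hge⟩

theorem exists_inverse {f : C(Realization K, Realization L)} (hf : IsSimpleHomotopyEquiv f) :
    ∃ g : C(Realization L, Realization K), IsSimpleHomotopyEquiv g ∧
      (g.comp f).Homotopic (.id _) ∧ (f.comp g).Homotopic (.id _) := by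
  obtain ⟨d, hd, hfd⟩ := isSimpleHomotopyEquiv_iff.1 hf
  obtain ⟨g, hg, h1, h2⟩ := hd.exists_inverse
  exact ⟨g, hg.isSimpleHomotopyEquiv, (ContinuousMap.Homotopic.comp (.refl g) hfd).trans h1,
    (ContinuousMap.Homotopic.comp hfd (.refl g)).trans h2⟩

theorem of_comp_left {f : C(Realization L, Realization M)} {g : C(Realization K, Realization L)}
    (hg : IsSimpleHomotopyEquiv g) (h : IsSimpleHomotopyEquiv (f.comp g)) :
    IsSimpleHomotopyEquiv f := by
  obtain ⟨g', hg', -, h2⟩ := hg.exists_inverse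
  exact (h.comp hg').congr (ContinuousMap.Homotopic.comp (.refl f) h2)

theorem of_comp_right {f : C(Realization L, Realization M)} {g : C(Realization K, Realization L)}
    (hf : IsSimpleHomotopyEquiv f) (h : IsSimpleHomotopyEquiv (f.comp g)) :
    IsSimpleHomotopyEquiv g := by
  obtain ⟨f', hf', h1, -⟩ := hf.exists_inverse
  exact (hf'.comp h).congr (ContinuousMap.Homotopic.comp h1 (.refl g))

theorem cancel_left {f : C(Realization L, Realization M)} {A : Type*} [TopologicalSpace A]
    {g h : C(A, Realization L)} (hf : IsSimpleHomotopyEquiv f)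
    (hgh : (f.comp g).Homotopic (f.comp h)) : g.Homotopic h := by
  obtain ⟨f', -, h1, -⟩ := hf.exists_inverse
  have h2 := ContinuousMap.Homotopic.comp h1 (.refl g)
  have h3 := ContinuousMap.Homotopic.comp h1 (.refl h)
  exact h2.symm.trans ((ContinuousMap.Homotopic.comp (.refl f') hgh).trans h3)

end IsSimpleHomotopyEquiv

/-- The simplicial mapping cylinder argument: if both ends of `M` are expansions and `ρ` retracts
`M` to the end `L`, then the restriction of `ρ` to the other end is a simple homotopy equivalence. -/
theorem isSimpleHomotopyEquiv_of_cylinder {φ : SimplicialMap K L} {i : SimplicialMap K M}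
    {j : SimplicialMap L M} (ρ : SimplicialMap M L) (hi : IsExpansion i) (hj : IsExpansion j)
    (hρi : ∀ v, ρ.toFun (i.toFun v) = φ.toFun v) (hρj : ∀ v, ρ.toFun (j.toFun v) = v) :
    IsSimpleHomotopyEquiv φ.realization := by
  have hi' := (IsDeformation.of_expansion hi).isSimpleHomotopyEquiv
  have hj' := (IsDeformation.of_expansion hj).isSimpleHomotopyEquiv
  have h1 : ρ.comp j = .id L := SimplicialMap.ext hρj
  have h2 : ρ.comp i = φ := SimplicialMap.ext hρi
  have hρ : IsSimpleHomotopyEquiv ρ.realization := by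
    refine .of_comp_left hj' ?_
    rw [← realization_comp, h1, realization_id]
    exact (IsDeformation.refl L).isSimpleHomotopyEquiv
  rw [← h2, realization_comp]
  exact hρ.comp hi'

end Collapse

/-! ### Clique complexes and dismantlable sets -/

section Clique

variable {V W : Type u}

theorem SimplicialMap.mem_of_image {K : AbstractSimplicialComplex V}
    {L : AbstractSimplicialComplex W} (φ : SimplicialMap K L) {s : Finset V} (hs : s ∈ K)
    {t : Finset W} (ht : ∀ w, w ∈ t ↔ ∃ v ∈ s, φ.toFun v = w) : t ∈ L := by
  classical
  convert φ.image_mem s hs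
  ext w
  rw [ht, Finset.mem_image]

theorem isExpansion_of_collapses {L : AbstractSimplicialComplex V}
    {K : AbstractSimplicialComplex W} {i : SimplicialMap L K} {Q : PreAbstractSimplicialComplex W}
    (hi : Function.Injective i.toFun)
    (hQ : ∀ t, t ∈ Q ↔ ∃ s ∈ L, ∀ w, w ∈ t ↔ ∃ v ∈ s, i.toFun v = w)
    (h : Collapses K.toPreAbstractSimplicialComplex Q) : IsExpansion i := by
  classical
  refine ⟨hi, ?_⟩
  convert h
  refine PreAbstractSimplicialComplex.ext (Set.ext fun t => Iff.trans ?_ (hQ t).symm)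
  refine exists_congr fun s => and_congr Iff.rfl ?_
  simp only [Finset.ext_iff, Finset.mem_image]
  exact forall_congr' fun w => Iff.comm

/-- If the simplices of `K` outside `L` are matched by adding and removing the vertex `z`, then
`K` collapses to `L`. -/
theorem collapses_of_toggle [Finite V] [inst : DecidableEq V] {K L : PreAbstractSimplicialComplex V}
    (hle : ∀ t ∈ L, t ∈ K) (z : V)
    (h : ∀ s ∈ K, s ∉ L → insert z s ∈ K ∧ s.erase z ∈ K ∧ s.erase z ∉ L) :
    Collapses K L := by
  -- The given decidable equality is replaced by the classical one built into `ElementaryCollapse`.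
  obtain rfl : inst = fun a b => Classical.propDecidable (a = b) := Subsingleton.elim _ _
  classical
  induction hn : {s | s ∈ K ∧ s ∉ L}.ncard using Nat.strong_induction_on generalizing K with
  | _ n ih =>
    by_cases hE : ∀ s ∈ K, s ∈ L
    · have : K = L := PreAbstractSimplicialComplex.ext
        (Set.Subset.antisymm (fun s hs => hE s hs) fun s hs => hle s hs)
      rw [this]
      exact .refl
    have hL : ∀ s ∉ L, s.Nonempty → ∀ t, s ⊆ t → t ∉ L := fun s hs hsn t hst ht =>
      hs ((L.isRelLowerSet_faces ht).2 hst hsn)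
    have hKn : ∀ s ∈ K, s.Nonempty := fun s hs => (K.isRelLowerSet_faces hs).1
    push Not at hE
    -- A simplex `s` of largest size outside `L` contains `z`, and `s.erase z` is a face of no
    -- simplex other than `s` and itself. Removing this matched pair is an elementary collapse that
    -- preserves the hypothesis on the remaining simplices.
    obtain ⟨s, ⟨hsK, hsL⟩, hmax⟩ := Set.exists_max_image {s | s ∈ K ∧ s ∉ L} Finset.card
      (Set.toFinite _) hE
    have hmax' : ∀ t ∈ K, s ⊆ insert z t → t ∉ L → insert z t = s := fun t ht hst htL =>
      (Finset.eq_of_subset_of_card_le hst (hmax _ ⟨(h t ht htL).1,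
        hL t htL (hKn t ht) _ (Finset.subset_insert _ _)⟩)).symm
    have hzs : z ∈ s := by
      have := hmax' s hsK (Finset.subset_insert _ _) hsL
      rw [← this]
      exact Finset.mem_insert_self _ _
    obtain ⟨-, hSK, hSL⟩ := h s hsK hsL
    have hins : insert z (s.erase z) = s := Finset.insert_erase hzs
    have hup : ∀ t ∈ K, s.erase z ⊆ t → t = s ∨ t = s.erase z := by
      intro t ht hSt
      have htL := hL _ hSL (hKn _ hSK) t hSt
      have h1 : insert z t = s :=
        hmax' t ht (by rw [← hins]; exact Finset.insert_subset_insert _ hSt) htL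
      by_cases hzt : z ∈ t
      · left; rwa [Finset.insert_eq_of_mem hzt] at h1
      · right; rw [← h1, Finset.erase_insert hzt]
    let K' : PreAbstractSimplicialComplex V :=
      { faces := {t | t ∈ K ∧ t ≠ s ∧ t ≠ s.erase z}
        isRelLowerSet_faces := fun t ht => ⟨hKn t ht.1, fun b hb hbn =>
          ⟨(K.isRelLowerSet_faces ht.1).2 hb hbn, by
            rintro rfl
            rcases hup t ht.1 ((Finset.erase_subset _ _).trans hb) with h | h
            · exact ht.2.1 h
            · exact ht.2.2 h, by
            rintro rfl
            rcases hup t ht.1 hb with h | h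
            · exact ht.2.1 h
            · exact ht.2.2 h⟩⟩ }
    have helem : ElementaryCollapse K K' := by
      refine ⟨s.erase z, hSK, z, (K.isRelLowerSet_faces hsK).2 (by simpa using hzs)
        (Finset.singleton_nonempty z), by simp, ?_, ?_⟩
      · rw [hins]
        refine PreAbstractSimplicialComplex.ext (Set.ext fun t => ⟨fun ht => ?_, fun ht => ?_⟩)
        · by_cases h1 : t = s
          · exact .inr ⟨hKn t ht, h1.le⟩
          by_cases h2 : t = s.erase z
          · exact .inr ⟨hKn t ht, h2.le.trans (Finset.erase_subset _ _)⟩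
          exact .inl ⟨ht, h1, h2⟩
        · rcases ht with ht | ht
          · exact ht.1
          · exact (K.isRelLowerSet_faces hsK).2 ht.2 ht.1
      · rw [hins]
        refine PreAbstractSimplicialComplex.ext (Set.ext fun t => ⟨fun ht => ?_, fun ht => ?_⟩)
        · refine ⟨ht.2.1, hins.symm ▸ ht.2.2, fun hSt => ?_⟩
          rcases hup t ht.1.1 hSt with h | h
          · exact ht.1.2.1 h
          · exact ht.1.2.2 h
        · have hts : t ⊆ s := hins ▸ ht.2.1
          refine ⟨⟨(K.isRelLowerSet_faces hsK).2 hts ht.1, ?_, ?_⟩, ht.1, hts⟩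
          · rintro rfl
            exact ht.2.2 (Finset.erase_subset _ _)
          · rintro rfl
            exact ht.2.2 subset_rfl
    refine .head helem (ih _ ?_ (K := K') (fun t ht => ⟨hle t ht, ?_, ?_⟩) ?_ rfl)
    · rw [← hn]
      refine Set.ncard_lt_ncard ⟨fun t ht => ⟨ht.1.1, ht.2⟩, fun hsub => ?_⟩ (Set.toFinite _)
      exact (hsub (show s ∈ {s | s ∈ K ∧ s ∉ L} from ⟨hsK, hsL⟩)).1.2.1 rfl
    · rintro rfl
      exact hsL ht
    · rintro rfl
      exact hSL ht
    · rintro t ⟨htK, h1, h2⟩ htL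
      obtain ⟨h3, h4, h5⟩ := h t htK htL
      refine ⟨⟨h3, fun h => ?_, fun h => ?_⟩, ⟨h4, fun h => ?_, fun h => ?_⟩, h5⟩
      · by_cases hzt : z ∈ t
        · exact h1 (by rwa [Finset.insert_eq_of_mem hzt] at h)
        · exact h2 (by rw [← h, Finset.erase_insert hzt])
      · have := Finset.mem_insert_self z t
        rw [h] at this
        simp at this
      · have : z ∈ t.erase z := h ▸ hzs
        simp at this
      · by_cases hzt : z ∈ t
        · exact h1 (by rw [← hins, ← h, Finset.insert_erase hzt])
        · exact h2 (by rwa [Finset.erase_eq_of_notMem hzt] at h)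

/-- The complex of finite cliques of the relation `r` in the set `A`. -/
def cliqueComplex (r : V → V → Prop) (A : Set V) : PreAbstractSimplicialComplex V where
  faces := {t | t.Nonempty ∧ (∀ v ∈ t, v ∈ A) ∧ ∀ v ∈ t, ∀ w ∈ t, r v w}
  isRelLowerSet_faces := fun _ ht => ⟨ht.1, fun _ hb hn =>
    ⟨hn, fun v hv => ht.2.1 v (hb hv), fun v hv w hw => ht.2.2 v (hb hv) w (hb hw)⟩⟩

/-- Sets which can be reduced to a point by removing vertices `x` dominated by another `z`. -/
inductive Dismantlable (r : V → V → Prop) : Set V → Prop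
  | single (p : V) : Dismantlable r {p}
  | step {D : Set V} {x z : V} : x ∈ D → z ∈ D → z ≠ x → (∀ w ∈ D, r w x → r w z) →
      Dismantlable r (D \ {x}) → Dismantlable r D

theorem Dismantlable.image {r : V → V → Prop} {r' : W → W → Prop} {D : Set V}
    (h : Dismantlable r D) {e : V → W} (he : Function.Injective e)
    (hr : ∀ a b, r' (e a) (e b) ↔ r a b) : Dismantlable r' (e '' D) := by
  induction h with
  | single p => rw [Set.image_singleton]; exact .single _
  | @step D x z hx hz hzx hd _ ih =>
    refine .step (Set.mem_image_of_mem e hx) (Set.mem_image_of_mem e hz) (he.ne hzx) ?_ ?_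
    · rintro _ ⟨w, hw, rfl⟩ hwx
      exact (hr _ _).2 (hd w hw ((hr _ _).1 hwx))
    · rwa [Set.image_sdiff he, Set.image_singleton] at ih

/-- A vertex may be removed from a clique complex by collapses if its link is the join of a
dismantlable set and another one. -/
theorem collapses_cliqueComplex_diff [Finite V] {r : V → V → Prop} (hrefl : ∀ v, r v v)
    (hsymm : ∀ v w, r v w → r w v) {A D : Set V} {x : V} (hD : Dismantlable r D) (hDA : D ⊆ A)
    (hxD : x ∉ D) (hxr : ∀ d ∈ D, r x d)
    (hlink : ∀ w ∈ A, r x w → w = x ∨ w ∈ D ∨ ∀ d ∈ D, r w d) :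
    Collapses (cliqueComplex r A) (cliqueComplex r (A \ {x})) := by
  classical
  -- In `E D'` a clique containing `x` may meet `D` only inside `D'`. Dismantling `D` shrinks `D'`:
  -- removing `y` dominated by `z` toggles `z` on the cliques containing `x` and `y`. Once `D' =
  -- {p}`, toggling `p` removes all cliques containing `x`.
  let E : Set V → PreAbstractSimplicialComplex V := fun D' =>
    { faces := {t | t ∈ cliqueComplex r A ∧ (x ∈ t → ∀ w ∈ t, w ∈ D → w ∈ D')}
      isRelLowerSet_faces := fun t ht => ⟨ht.1.1, fun b hb hn =>
        ⟨((cliqueComplex r A).isRelLowerSet_faces ht.1).2 hb hn,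
          fun hx w hw => ht.2 (hb hx) w (hb hw)⟩⟩ }
  have hED : E D = cliqueComplex r A :=
    PreAbstractSimplicialComplex.ext (Set.ext fun t => ⟨fun h => h.1, fun h => ⟨h, by tauto⟩⟩)
  have hins : ∀ D' t z, t ∈ E D' → z ∈ D' → z ∈ D → (∀ w ∈ t, r w z) → insert z t ∈ E D' := by
    intro D' t z ht hz hzD hw
    refine ⟨⟨Finset.insert_nonempty _ _, fun v hv => ?_, fun v hv w hw' => ?_⟩, fun hx w hw' hwD => ?_⟩
    · rcases Finset.mem_insert.1 hv with rfl | hv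
      · exact hDA hzD
      · exact ht.1.2.1 v hv
    · rcases Finset.mem_insert.1 hv with rfl | hv1 <;>
        rcases Finset.mem_insert.1 hw' with rfl | hw1
      · exact hrefl _
      · exact hsymm _ _ (hw w hw1)
      · exact hw v hv1
      · exact ht.1.2.2 v hv1 w hw1
    · have hxt : x ∈ t := by
        rcases Finset.mem_insert.1 hx with rfl | hx
        · exact absurd hzD hxD
        · exact hx
      rcases Finset.mem_insert.1 hw' with rfl | hw'
      · exact hz
      · exact ht.2 hxt w hw' hwD
  have her : ∀ D' t z, t ∈ E D' → x ∈ t → z ≠ x → t.erase z ∈ E D' := fun D' t z ht hx hz =>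
    ((E D').isRelLowerSet_faces ht).2 (Finset.erase_subset _ _)
      ⟨x, Finset.mem_erase.2 ⟨hz.symm, hx⟩⟩
  -- By the join structure of the link, only the vertices of the clique in `D'` can obstruct adding
  -- `z`.
  have hadj : ∀ D' t z, t ∈ E D' → x ∈ t → z ∈ D → (∀ w ∈ t, w ∈ D' → w ∈ D → r w z) →
      ∀ w ∈ t, r w z := by
    intro D' t z ht hx hz hw w hwt
    rcases hlink w (ht.1.2.1 w hwt) (ht.1.2.2 x hx w hwt) with rfl | h | h
    · exact hxr z hz
    · exact hw w hwt (ht.2 hx w hwt h) h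
    · exact h z hz
  have key : ∀ D', Dismantlable r D' → D' ⊆ D →
      Collapses (E D') (cliqueComplex r (A \ {x})) := by
    intro D' hD'
    induction hD' with
    | single p =>
      intro hpD
      have hp : p ∈ D := hpD rfl
      have hpx : p ≠ x := fun h => hxD (h ▸ hp)
      refine collapses_of_toggle (fun t ht => ⟨⟨ht.1, fun v hv => (ht.2.1 v hv).1, ht.2.2⟩,
        fun hx => absurd rfl (ht.2.1 x hx).2⟩) p fun s hs hsL => ?_
      have hx : x ∈ s := by
        by_contra hx
        exact hsL ⟨hs.1.1, fun v hv => ⟨hs.1.2.1 v hv, fun h => hx (h ▸ hv)⟩, hs.1.2.2⟩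
      refine ⟨hins _ _ _ hs rfl hp (hadj _ _ _ hs hx hp fun w _ hw _ => ?_),
        her _ _ _ hs hx hpx, fun h => (h.2.1 x (Finset.mem_erase.2 ⟨hpx.symm, hx⟩)).2 rfl⟩
      rw [Set.mem_singleton_iff.1 hw]
      exact hrefl p
    | @step D' y z hy hz hzy hd _ ih =>
      intro hDD
      have hzx : z ≠ x := fun h => hxD (h ▸ hDD hz)
      refine .trans (collapses_of_toggle (L := E (D' \ {y})) (fun t ht => ⟨ht.1, fun hx w hw hwD =>
        (ht.2 hx w hw hwD).1⟩) z fun s hs hsL => ?_) (ih (Set.sdiff_subset.trans hDD))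
      have hxs : x ∈ s ∧ y ∈ s := by
        have h1 : ¬ (x ∈ s → ∀ w ∈ s, w ∈ D → w ∈ D' \ {y}) := fun h => hsL ⟨hs.1, h⟩
        push Not at h1
        obtain ⟨hx, w, hw, hwD, hwy⟩ := h1
        refine ⟨hx, ?_⟩
        have : w = y := by
          by_contra hne
          exact hwy ⟨hs.2 hx w hw hwD, hne⟩
        exact this ▸ hw
      refine ⟨hins _ _ _ hs hz (hDD hz) (hadj _ _ _ hs hxs.1 (hDD hz) fun w hw hwD' _ => ?_),
        her _ _ _ hs hxs.1 hzx, fun h => ?_⟩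
      · exact hd w hwD' (hs.1.2.2 w hw y hxs.2)
      · exact (h.2 (Finset.mem_erase.2 ⟨hzx.symm, hxs.1⟩) y
          (Finset.mem_erase.2 ⟨hzy.symm, hxs.2⟩) (hDD hy)).2 rfl
  rw [← hED]
  exact key D hD subset_rfl

end Clique

/-! ### Contractible finite spaces are dismantlable -/

section Dismantle

variable {X Y : Type u} [TopologicalSpace X] [TopologicalSpace Y]

/-- Comparability in the specialization order. -/
def Comparable (x y : X) : Prop := x ⤳ y ∨ y ⤳ x

theorem exists_maximal_specializes [Finite X] [T0Space X] {S : Set X} (hS : S.Nonempty) :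
    ∃ x ∈ S, ∀ y ∈ S, x ⤳ y → y = x := by
  let _ := specializationOrder X
  -- `specializationOrder` is opposite to the order `x ⤳ y` used here, so its minimal elements are
  -- the maximal ones.
  obtain ⟨x, hx⟩ := S.toFinite.exists_minimal hS
  exact ⟨x, hx.1, fun y hy hxy => hx.eq_of_le hy hxy⟩

theorem exists_minimal_specializes [Finite X] [T0Space X] {S : Set X} (hS : S.Nonempty) :
    ∃ x ∈ S, ∀ y ∈ S, y ⤳ x → y = x := by
  let _ := specializationOrder X
  obtain ⟨x, hx⟩ := S.toFinite.exists_maximal hS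
  exact ⟨x, hx.1, fun y hy hxy => (hx.eq_of_ge hy hxy)⟩

/-- A contractible finite `T₀`-space with at least two points has a beat point `x`. -/
theorem exists_beat_point [Finite X] [T0Space X] [ContractibleSpace X] [Nontrivial X] :
    ∃ x z : X, z ≠ x ∧ (∀ w, w ≠ x → w ⤳ x → w ⤳ z) ∧ (∀ w, w ≠ x → x ⤳ w → z ⤳ w) ∧
      (x ⤳ z ∨ z ⤳ x) := by
  obtain ⟨p, hp⟩ := id_nullhomotopic X
  have hfence := eqvGen_of_homotopic hp
  -- If the identity were comparable only to itself, a fence starting there could never reach a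
  -- constant map.
  have : ∃ g : C(X, X), g ≠ ContinuousMap.id X ∧ ((∀ x, x ⤳ g x) ∨ ∀ x, g x ⤳ x) := by
    by_contra! hcon
    have key : ∀ f g : C(X, X), Relation.EqvGen (fun f g : C(X, X) => ∀ x, f x ⤳ g x) f g →
        (f = ContinuousMap.id X ↔ g = ContinuousMap.id X) := by
      intro f g h
      induction h with
      | rel f g h =>
        constructor
        · rintro rfl
          by_contra hg
          obtain ⟨x, hx⟩ := (hcon g hg).1
          exact hx (h x)
        · rintro rfl
          by_contra hf
          obtain ⟨x, hx⟩ := (hcon f hf).2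
          exact hx (h x)
      | refl => exact Iff.rfl
      | symm _ _ _ ih => exact ih.symm
      | trans _ _ _ _ _ ih1 ih2 => exact ih1.trans ih2
    have hid := (key _ _ hfence).1 rfl
    obtain ⟨q, hq⟩ := exists_ne p
    exact hq (DFunLike.congr_fun hid q).symm
  obtain ⟨g, hg, h⟩ := this
  have hne : {x | g x ≠ x}.Nonempty := by
    by_contra hcon
    refine hg (ContinuousMap.ext fun x => ?_)
    by_contra hx
    exact hcon ⟨x, hx⟩
  rcases h with h | h
  -- Take `x` maximal among the points moved by `g ≥ id`. Any `w > x` is fixed, so `g x ≤ g w = w`,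
  -- and `g x` serves as `z`. The other case is dual.
  · obtain ⟨x, hx, hmax⟩ := exists_maximal_specializes hne
    refine ⟨x, g x, hx, fun w _ hw => hw.trans (h x), fun w hwx hw => ?_, .inl (h x)⟩
    have : g w = w := by
      by_contra hgw
      exact hwx (hmax w hgw hw)
    exact this ▸ hw.map g.continuous
  · obtain ⟨x, hx, hmin⟩ := exists_minimal_specializes hne
    refine ⟨x, g x, hx, fun w hwx hw => ?_, fun w _ hw => (h x).trans hw, .inr (h x)⟩
    have : g w = w := by
      by_contra hgw
      exact hwx (hmin w hgw hw)
    exact this ▸ hw.map g.continuous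

/-- Sending a beat point `x` to `z` is a continuous retraction onto the complement of `x`. A retract
of a contractible space is contractible, so the removal can be repeated. -/
theorem dismantlable_of_contractibleSpace {X : Type u} [TopologicalSpace X] [Finite X] [T0Space X]
    [ContractibleSpace X] : Dismantlable Comparable (Set.univ : Set X) := by
  classical
  induction hn : Nat.card X using Nat.strong_induction_on generalizing X with
  | _ n ih =>
    rcases subsingleton_or_nontrivial X with hX | hX
    · have p : X := (inferInstance : Nonempty X).some
      rw [Set.Subsingleton.eq_singleton_of_mem (Set.subsingleton_univ) (Set.mem_univ p)]
      exact .single p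
    obtain ⟨x, z, hzx, hdown, hup, hxz⟩ := exists_beat_point (X := X)
    let ρ : C(X, {w : X // w ≠ x}) :=
      ⟨fun w => if h : w = x then ⟨z, hzx⟩ else ⟨w, h⟩, continuous_of_specializes fun a b hab => by
        rw [subtype_specializes_iff]
        by_cases ha : a = x <;> by_cases hb : b = x
        · simp [ha, hb, specializes_rfl]
        · simpa [ha, hb] using hup b hb (ha ▸ hab)
        · simpa [ha, hb] using hdown a ha (hb ▸ hab)
        · simpa [ha, hb] using hab⟩
    let j : C({w : X // w ≠ x}, X) := ⟨Subtype.val, continuous_subtype_val⟩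
    have hρj : ρ.comp j = ContinuousMap.id _ := by
      ext1 w
      exact dif_neg w.2
    have : ContractibleSpace {w : X // w ≠ x} := by
      rw [contractible_iff_id_nullhomotopic, ← hρj]
      simpa using ((id_nullhomotopic X).comp_right ρ).comp_left j
    have hcard : Nat.card {w : X // w ≠ x} < n := by
      rw [← hn]
      exact Finite.card_subtype_lt (x := x) (by simp)
    have h := (ih _ hcard (X := {w : X // w ≠ x}) rfl).image (r' := Comparable)
      Subtype.val_injective fun a b => or_congr subtype_specializes_iff.symm
        subtype_specializes_iff.symm
    refine .step (Set.mem_univ x) (Set.mem_univ z) hzx (fun w _ hw => ?_) ?_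
    · by_cases hwx : w = x
      · rw [hwx]; exact hxz
      · exact hw.imp (hdown w hwx) (hup w hwx)
    · convert h using 1
      ext w
      simp

end Dismantle

/-! ### Distinguished maps induce simple homotopy equivalences -/

section Cylinder

variable {X Y : Type u} [TopologicalSpace X] [TopologicalSpace Y]

theorem mem_orderComplex_iff {s : Finset X} :
    s ∈ orderComplex X ↔ s.Nonempty ∧ ∀ a ∈ s, ∀ b ∈ s, Comparable a b := by
  refine and_congr Iff.rfl ⟨fun h a ha b hb => ?_, fun h a ha b hb _ => ?_⟩
  · by_cases hab : a = b
    · rw [hab]; exact .inl specializes_rfl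
    · exact (h ha hb hab).imp mem_minOpen_iff.1 mem_minOpen_iff.1
  · exact (h a ha b hb).imp mem_minOpen_iff.2 mem_minOpen_iff.2

open Classical in
theorem nonempty_image {V W : Type u} (f : V → W) {s : Finset V} (h : s.Nonempty) :
    (s.image f).Nonempty :=
  h.image f

/-- The order of the mapping cylinder of `f`. -/
def cylLE (f : X → Y) : X ⊕ Y → X ⊕ Y → Prop
  | .inl x, .inl x' => x ⤳ x'
  | .inl x, .inr y => f x ⤳ y
  | .inr _, .inl _ => False
  | .inr y, .inr y' => y ⤳ y'

/-- Comparability in the mapping cylinder. -/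
def cylComparable (f : X → Y) (a b : X ⊕ Y) : Prop := cylLE f a b ∨ cylLE f b a

theorem cylComparable_refl (f : X → Y) (a : X ⊕ Y) : cylComparable f a a := by
  rcases a with a | a <;> exact .inl specializes_rfl

/-- The order complex of the mapping cylinder. -/
def cylinderComplex (f : X → Y) : AbstractSimplicialComplex (X ⊕ Y) where
  toPreAbstractSimplicialComplex := cliqueComplex (cylComparable f) Set.univ
  singleton_mem v := ⟨Finset.singleton_nonempty v, fun _ _ => Set.mem_univ _, fun a ha b hb => by
    rw [Finset.mem_singleton.1 ha, Finset.mem_singleton.1 hb]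
    exact cylComparable_refl f v⟩

theorem mem_cylinderComplex {f : X → Y} {t : Finset (X ⊕ Y)} :
    t ∈ cylinderComplex f ↔ t.Nonempty ∧ ∀ v ∈ t, ∀ w ∈ t, cylComparable f v w :=
  ⟨fun h => ⟨h.1, h.2.2⟩, fun h => ⟨h.1, fun _ _ => Set.mem_univ _, h.2⟩⟩

open Classical in
/-- The inclusion of the domain in the mapping cylinder. -/
def cylinderInl (f : X → Y) : SimplicialMap (orderComplex X) (cylinderComplex f) where
  toFun := Sum.inl
  image_mem s hs := by
    obtain ⟨h1, h2⟩ := mem_orderComplex_iff.1 hs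
    refine mem_cylinderComplex.2 ⟨nonempty_image _ h1, ?_⟩
    simp only [Finset.forall_mem_image]
    exact h2

open Classical in
/-- The inclusion of the codomain in the mapping cylinder. -/
def cylinderInr (f : X → Y) : SimplicialMap (orderComplex Y) (cylinderComplex f) where
  toFun := Sum.inr
  image_mem s hs := by
    obtain ⟨h1, h2⟩ := mem_orderComplex_iff.1 hs
    refine mem_cylinderComplex.2 ⟨nonempty_image _ h1, ?_⟩
    simp only [Finset.forall_mem_image]
    exact h2

open Classical in
/-- The retraction of the mapping cylinder to the codomain. -/
def cylinderProj (f : C(X, Y)) : SimplicialMap (cylinderComplex f) (orderComplex Y) where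
  toFun := Sum.elim f id
  image_mem s hs := by
    obtain ⟨h1, h2⟩ := mem_cylinderComplex.1 hs
    refine mem_orderComplex_iff.2 ⟨h1.image _, ?_⟩
    simp only [Finset.forall_mem_image]
    have hle : ∀ a b, cylLE f a b → Sum.elim f id a ⤳ Sum.elim f id b := by
      rintro (a | a) (b | b) h
      · exact Specializes.map (x := a) (y := b) h f.continuous
      · exact h
      · exact h.elim
      · exact h
    exact fun a ha b hb => (h2 a ha b hb).imp (hle a b) (hle b a)

/-- A full subcomplex of a clique complex as the image of an order complex. -/
theorem mem_cliqueComplex_range_iff {Z : Type u} {r : Z → Z → Prop} {e : X → Z}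
    (hr : ∀ a b, r (e a) (e b) ↔ Comparable a b) (t : Finset Z) :
    t ∈ cliqueComplex r (Set.range e) ↔
      ∃ s ∈ orderComplex X, ∀ w, w ∈ t ↔ ∃ v ∈ s, e v = w := by
  classical
  constructor
  · rintro ⟨h1, h2, h3⟩
    obtain ⟨s, rfl⟩ : ∃ s : Finset X, s.image e = t := by
      obtain ⟨s, -, hs⟩ := Finset.subset_set_image_iff.1
        (show (t : Set Z) ⊆ e '' Set.univ by rw [Set.image_univ]; exact fun v hv => h2 v hv)
      exact ⟨s, hs⟩
    refine ⟨s, mem_orderComplex_iff.2 ⟨Finset.image_nonempty.1 h1, fun a ha b hb => ?_⟩,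
      fun w => Finset.mem_image⟩
    exact (hr _ _).1 (h3 _ (Finset.mem_image_of_mem e ha) _ (Finset.mem_image_of_mem e hb))
  · rintro ⟨s, hs, ht⟩
    obtain ⟨⟨a, ha⟩, h2⟩ := mem_orderComplex_iff.1 hs
    refine ⟨⟨e a, (ht _).2 ⟨a, ha, rfl⟩⟩, fun v hv => ?_, fun v hv w hw => ?_⟩
    · obtain ⟨b, -, rfl⟩ := (ht v).1 hv
      exact ⟨b, rfl⟩
    · obtain ⟨b, hb, rfl⟩ := (ht v).1 hv
      obtain ⟨c, hc, rfl⟩ := (ht w).1 hw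
      exact (hr _ _).2 (h2 b hb c hc)

variable [Finite X] [T0Space X] [Finite Y]

/-- Points of `X` are removed from the top down. When `x` is maximal among those left, every other
vertex comparable to it lies below `x` or above `f x`, hence is comparable to `f x`: the link is a
cone with apex `f x`. -/
theorem isExpansion_cylinderInr (f : C(X, Y)) : IsExpansion (cylinderInr f) := by
  have key : ∀ T : Set X, (∀ a b, a ⤳ b → b ∈ T → a ∈ T) →
      Collapses (cliqueComplex (cylComparable f) (Sum.inl '' T ∪ Set.range Sum.inr))
        (cliqueComplex (cylComparable f) (Set.range Sum.inr)) := by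
    intro T
    induction T using WellFoundedLT.induction with
    | _ T ih =>
    intro hT
    rcases T.eq_empty_or_nonempty with rfl | hne
    · rw [Set.image_empty, Set.empty_union]
      exact .refl
    obtain ⟨x, hx, hmax⟩ := exists_maximal_specializes hne
    refine .trans (collapses_cliqueComplex_diff (cylComparable_refl f) (fun _ _ => Or.symm)
      (Dismantlable.single (Sum.inr (f x))) (x := Sum.inl x) ?_ ?_ ?_ ?_) ?_
    · rintro _ rfl
      exact .inr ⟨_, rfl⟩
    · simp
    · rintro _ rfl
      exact .inl (specializes_rfl (x := f x))
    · rintro _ (⟨w, hw, rfl⟩ | ⟨y, rfl⟩) h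
      · rcases h with h | h
        · exact .inl (congrArg _ (hmax w hw h))
        · refine .inr (.inr fun d hd => ?_)
          rw [Set.mem_singleton_iff.1 hd]
          exact .inl (Specializes.map h f.continuous)
      · refine .inr (.inr fun d hd => ?_)
        rw [Set.mem_singleton_iff.1 hd]
        rcases h with h | h
        · exact .inr h
        · exact h.elim
    · have : (Sum.inl '' T ∪ Set.range Sum.inr) \ {Sum.inl x} =
          Sum.inl '' (T \ {x}) ∪ Set.range (Sum.inr : Y → X ⊕ Y) := by
        ext (w | w) <;> simp
      rw [this]
      refine ih _ ⟨Set.sdiff_subset, fun h => (h hx).2 rfl⟩ fun a b hab hb => ⟨hT a b hab hb.1, ?_⟩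
      rintro rfl
      exact hb.2 (hmax b hb.1 hab)
  refine isExpansion_of_collapses Sum.inr_injective
    (mem_cliqueComplex_range_iff (r := cylComparable f) (e := Sum.inr) fun a b => Iff.rfl) ?_
  have := key Set.univ fun _ _ _ _ => Set.mem_univ _
  rwa [Set.image_univ, Set.range_inl_union_range_inr] at this

/-- Points of `Y` are removed from the bottom up. When `y` is minimal among those left, its link is
the join of the complexes of `f⁻¹(U_y)` and of the points above `y`. Distinguishedness makes the
first set contractible, hence dismantlable. -/
theorem isExpansion_cylinderInl [T0Space Y] {f : C(X, Y)} (hf : IsDistinguished f) :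
    IsExpansion (cylinderInl f) := by
  have key : ∀ T : Set Y, (∀ a b, a ⤳ b → a ∈ T → b ∈ T) →
      Collapses (cliqueComplex (cylComparable f) (Set.range Sum.inl ∪ Sum.inr '' T))
        (cliqueComplex (cylComparable f) (Set.range Sum.inl)) := by
    intro T
    induction T using WellFoundedLT.induction with
    | _ T ih =>
    intro hT
    rcases T.eq_empty_or_nonempty with rfl | hne
    · rw [Set.image_empty, Set.union_empty]
      exact .refl
    obtain ⟨y, hy, hmin⟩ := exists_minimal_specializes hne
    have := isDistinguished_iff.1 hf y
    have hD := (dismantlable_of_contractibleSpace (X := {x // f x ⤳ y})).image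
      (r' := cylComparable f) (e := fun x => Sum.inl x.1)
      (Sum.inl_injective.comp Subtype.val_injective)
      fun a b => or_congr subtype_specializes_iff.symm subtype_specializes_iff.symm
    refine .trans (collapses_cliqueComplex_diff (cylComparable_refl f) (fun _ _ => Or.symm)
      hD (x := Sum.inr y) ?_ ?_ ?_ ?_) ?_
    · rintro _ ⟨x, -, rfl⟩
      exact .inl ⟨_, rfl⟩
    · simp
    · rintro _ ⟨x, -, rfl⟩
      exact .inr x.2
    · rintro _ (⟨x, rfl⟩ | ⟨w, hw, rfl⟩) h
      · rcases h with h | h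
        · exact h.elim
        · exact .inr (.inl ⟨⟨x, h⟩, Set.mem_univ _, rfl⟩)
      · rcases h with h | h
        · refine .inr (.inr ?_)
          rintro _ ⟨x, -, rfl⟩
          exact .inr (x.2.trans h)
        · exact .inl (congrArg _ (hmin w hw h))
    · have : (Set.range Sum.inl ∪ Sum.inr '' T) \ {Sum.inr y} =
          Set.range (Sum.inl : X → X ⊕ Y) ∪ Sum.inr '' (T \ {y}) := by
        ext (w | w) <;> simp
      rw [this]
      refine ih _ ⟨Set.sdiff_subset, fun h => (h hy).2 rfl⟩ fun a b hab ha => ⟨hT a b hab ha.1, ?_⟩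
      rintro rfl
      exact ha.2 (hmin a ha.1 hab)
  refine isExpansion_of_collapses Sum.inl_injective
    (mem_cliqueComplex_range_iff (r := cylComparable f) (e := Sum.inl) fun a b => Iff.rfl) ?_
  have := key Set.univ fun _ _ _ _ => Set.mem_univ _
  rwa [Set.image_univ, Set.range_inl_union_range_inr] at this

end Cylinder

/-! ### Homotopy invariance of the order complex -/

section Simple

variable {X Y : Type u} [TopologicalSpace X] [Fintype X]
  [TopologicalSpace Y] [Fintype Y]

theorem IsDistinguished.isSimpleHomotopyEquiv [T0Space X] [T0Space Y] {f : C(X, Y)} (hf : IsDistinguished f) :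
    IsSimpleHomotopyEquiv (orderComplexMap f).realization :=
  isSimpleHomotopyEquiv_of_cylinder (cylinderProj f) (isExpansion_cylinderInl hf)
    (isExpansion_cylinderInr f) (fun _ => rfl) fun _ => rfl

theorem orderComplexMap_comp {Z : Type u} [TopologicalSpace Z] [Fintype Z] (f : C(Y, Z))
    (g : C(X, Y)) : (orderComplexMap (f.comp g)).realization =
      (orderComplexMap f).realization.comp (orderComplexMap g).realization :=
  realization_comp (orderComplexMap f) (orderComplexMap g)

/-- Comparable maps induce homotopic maps of order complexes. -/
theorem orderComplexMap_homotopic_of_specializes [T0Space X] {f g : C(X, Y)} (h : ∀ x, f x ⤳ g x) :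
    (orderComplexMap f).realization.Homotopic (orderComplexMap g).realization := by
  classical
  -- For a chain `c`, the set `f(c) ∪ g(c)` need not be a chain, so contiguity is not available.
  -- Instead `f` and `g` are glued on `X × Prop`, where `Prop` is the Sierpiński space with `True <
  -- False`. The projection to `X` is distinguished, hence a simple homotopy equivalence on order
  -- complexes, and can be cancelled from its two sections.
  let pr : C(X × Prop, X) := ⟨Prod.fst, continuous_fst⟩
  have hpr : IsDistinguished pr := isDistinguished_of_adjoint (fun x => (x, False)) fun p x => by
    rw [show p = (p.1, p.2) from rfl, specializes_prod]
    simp [Specializes, nhds_false, pr]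
  have hs : ∀ p : Prop, Continuous fun x : X => (x, p) := fun p => by fun_prop
  let s : Prop → C(X, X × Prop) := fun p => ⟨fun x => (x, p), hs p⟩
  let H : C(X × Prop, Y) := ⟨fun p => if p.2 then f p.1 else g p.1, ⟨fun U hU => by
    have : (fun p : X × Prop => if p.2 then f p.1 else g p.1) ⁻¹' U =
        ((f ⁻¹' U) ×ˢ {True}) ∪ ((g ⁻¹' U) ×ˢ Set.univ) := by
      ext ⟨x, p⟩
      by_cases hp : p
      · simpa [hp] using fun hx => (h x).mem_open hU hx
      · simp [hp]
    rw [this]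
    exact ((hU.preimage f.continuous).prod isOpen_singleton_true).union
      ((hU.preimage g.continuous).prod isOpen_univ)⟩⟩
  have hst : (orderComplexMap (s True)).realization.Homotopic
      (orderComplexMap (s False)).realization := by
    refine hpr.isSimpleHomotopyEquiv.cancel_left ?_
    rw [← orderComplexMap_comp, ← orderComplexMap_comp]
    exact .refl _
  have hf : H.comp (s True) = f := ContinuousMap.ext fun x => if_pos trivial
  have hg : H.comp (s False) = g := ContinuousMap.ext fun x => if_neg not_false
  rw [← hf, ← hg, orderComplexMap_comp, orderComplexMap_comp]
  exact .comp (.refl _) hst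

theorem orderComplexMap_homotopic [T0Space X] {f g : C(X, Y)} (h : f.Homotopic g) :
    (orderComplexMap f).realization.Homotopic (orderComplexMap g).realization := by
  have hfg := eqvGen_of_homotopic h
  clear h
  induction hfg with
  | rel f g h => exact orderComplexMap_homotopic_of_specializes h
  | refl => exact .refl _
  | symm f g _ ih => exact ih.symm
  | trans f g k _ _ ih1 ih2 => exact ih1.trans ih2

end Simple

/-- The maps in the class generated by the distinguished maps induce simple homotopy
equivalences of order complexes. -/
theorem InDBar.isSimpleHomotopyEquiv {X Y : Type u} [TopologicalSpace X] [Fintype X] [T0Space X]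
    [TopologicalSpace Y] [Fintype Y] [T0Space Y] {f : C(X, Y)} (hf : InDBar f) :
    IsSimpleHomotopyEquiv (orderComplexMap f).realization := by
  have key : ∀ {X Y : Type u} [TopologicalSpace X] [Finite X] [T0Space X]
      [TopologicalSpace Y] [Finite Y] [T0Space Y] {f : C(X, Y)}, InDBar f →
      ∀ [Fintype X] [Fintype Y], IsSimpleHomotopyEquiv (orderComplexMap f).realization := by
    intro X Y _ _ _ _ _ _ f hf
    induction hf with
    | base h =>
      intro _ _
      exact IsDistinguished.isSimpleHomotopyEquiv h
    | @comp X Y Z _ _ _ _ _ _ _ _ _ f g h hfg _ _ ih1 ih2 =>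
      intro _ _
      have := Fintype.ofFinite Y
      have h1 := orderComplexMap_homotopic hfg
      rw [orderComplexMap_comp] at h1
      exact (ih1.comp ih2).congr h1
    | @left X Y Z _ _ _ _ _ _ _ _ _ f g h hfg _ _ ih1 ih2 =>
      intro _ _
      have := Fintype.ofFinite X
      have h1 := orderComplexMap_homotopic hfg
      rw [orderComplexMap_comp] at h1
      exact .of_comp_left ih1 (ih2.congr h1.symm)
    | @right X Y Z _ _ _ _ _ _ _ _ _ f g h hfg _ _ ih1 ih2 =>
      intro _ _
      have := Fintype.ofFinite Z
      have h1 := orderComplexMap_homotopic hfg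
      rw [orderComplexMap_comp] at h1
      exact .of_comp_right ih1 (ih2.congr h1.symm)
  exact key hf

/-! ### Barycentric subdivision -/

section Barycentric

variable {V W : Type u} {K : AbstractSimplicialComplex V} {L : AbstractSimplicialComplex W}

noncomputable instance [Finite V] : Fintype (FaceSpace K) := Fintype.ofFinite _

open Classical in
/-- A map of vertices which sends each simplex into some simplex is simplicial. -/
def SimplicialMap.ofSubset (f : V → W) (h : ∀ s ∈ K, ∃ t ∈ L, ∀ v ∈ s, f v ∈ t) :
    SimplicialMap K L where
  toFun := f
  image_mem s hs := by
    obtain ⟨t, ht, hst⟩ := h s hs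
    exact face_of_subset ht (Finset.image_subset_iff.2 hst) ((face_nonempty hs).image f)

theorem contiguous_of_subset {φ ψ : SimplicialMap K L}
    (h : ∀ s ∈ K, ∃ t ∈ L, ∀ v ∈ s, φ.toFun v ∈ t ∧ ψ.toFun v ∈ t) : Contiguous φ ψ := by
  classical
  intro s hs
  obtain ⟨t, ht, hst⟩ := h s hs
  exact face_of_subset ht (Finset.union_subset (Finset.image_subset_iff.2 fun v hv => (hst v hv).1)
    (Finset.image_subset_iff.2 fun v hv => (hst v hv).2))
    (((face_nonempty hs).image _).mono Finset.subset_union_left)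

theorem exists_max_of_comparable {X : Type u} [TopologicalSpace X] {c : Finset X}
    (hc : c.Nonempty) (h : ∀ a ∈ c, ∀ b ∈ c, Comparable a b) : ∃ m ∈ c, ∀ x ∈ c, x ⤳ m := by
  let _ := specializationPreorder X
  obtain ⟨m, hm⟩ := c.finite_toSet.exists_minimal hc
  refine ⟨m, hm.1, fun x hx => (h x hx m hm.1).elim id fun hmx => hm.2 hx hmx⟩

/-- A vertex of each simplex. -/
noncomputable def chosenVertex (s : FaceSpace K) : V := (face_nonempty s.2).choose

theorem chosenVertex_mem (s : FaceSpace K) : chosenVertex s ∈ s.1 := (face_nonempty s.2).choose_spec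

theorem exists_face_of_chain {c : Finset (FaceSpace K)} (hc : c ∈ orderComplex (FaceSpace K)) :
    ∃ m ∈ c, ∀ s ∈ c, s.1 ⊆ m.1 := by
  obtain ⟨h1, h2⟩ := mem_orderComplex_iff.1 hc
  obtain ⟨m, hm, h⟩ := exists_max_of_comparable h1 h2
  exact ⟨m, hm, fun s hs => FaceSpace.specializes_iff.1 (h s hs)⟩

/-- A simplicial approximation of the identity, from the barycentric subdivision of `K` to `K`. -/
noncomputable def subdivisionMap (K : AbstractSimplicialComplex V) :
    SimplicialMap (orderComplex (FaceSpace K)) K :=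
  .ofSubset chosenVertex fun c hc => by
    obtain ⟨m, -, h⟩ := exists_face_of_chain hc
    exact ⟨m.1, m.2, fun s hs => h s hs (chosenVertex_mem s)⟩

/-- If `m` is the largest simplex of a chain, both composites send the chain into `φ(m)`. -/
theorem subdivisionMap_natural (φ : SimplicialMap K L) :
    Contiguous (φ.comp (subdivisionMap K))
      ((subdivisionMap L).comp (orderComplexMap (faceSpaceMap φ))) := by
  classical
  refine contiguous_of_subset fun c hc => ?_
  obtain ⟨m, -, h⟩ := exists_face_of_chain hc
  refine ⟨(faceSpaceMap φ m).1, (faceSpaceMap φ m).2, fun s hs => ⟨?_, ?_⟩⟩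
  · exact Finset.mem_image_of_mem _ (h s hs (chosenVertex_mem s))
  · exact Finset.image_subset_image (h s hs) (chosenVertex_mem (faceSpaceMap φ s))

/-- The mapping cylinder of the subdivision map: joins of a chain of simplices with a simplex
contained in all of them. -/
def subdivisionCylinder (K : AbstractSimplicialComplex V) :
    AbstractSimplicialComplex (FaceSpace K ⊕ V) where
  faces := {t | t.Nonempty ∧ (∀ s s' : FaceSpace K, .inl s ∈ t → .inl s' ∈ t → Comparable s s') ∧
    (∀ (s : FaceSpace K) (v : V), .inl s ∈ t → .inr v ∈ t → v ∈ s.1) ∧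
    (t.toRight.Nonempty → t.toRight ∈ K)}
  isRelLowerSet_faces := fun t ht => ⟨ht.1, fun b hb hn => ⟨hn,
    fun s s' h h' => ht.2.1 s s' (hb h) (hb h'), fun s v h h' => ht.2.2.1 s v (hb h) (hb h'),
    fun h => face_of_subset (ht.2.2.2 (h.mono (Finset.toRight_subset_toRight hb)))
      (Finset.toRight_subset_toRight hb) h⟩⟩
  singleton_mem v := by
    refine ⟨Finset.singleton_nonempty v, fun s s' h h' => ?_, fun s w h h' => ?_, fun h => ?_⟩
    · rw [Finset.mem_singleton] at h h'
      have := h.trans h'.symm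
      rw [Sum.inl.inj this]
      exact .inl specializes_rfl
    · rw [Finset.mem_singleton] at h h'
      cases h.trans h'.symm
    · obtain ⟨w, hw⟩ := h
      rw [Finset.mem_toRight, Finset.mem_singleton] at hw
      subst hw
      have : ({.inr w} : Finset (FaceSpace K ⊕ V)).toRight = {w} := by ext; simp
      rw [this]
      exact K.singleton_mem w

theorem mem_subdivisionCylinder {t : Finset (FaceSpace K ⊕ V)} : t ∈ subdivisionCylinder K ↔
    t.Nonempty ∧ (∀ s s' : FaceSpace K, .inl s ∈ t → .inl s' ∈ t → Comparable s s') ∧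
    (∀ (s : FaceSpace K) (v : V), .inl s ∈ t → .inr v ∈ t → v ∈ s.1) ∧
    (t.toRight.Nonempty → t.toRight ∈ K) := Iff.rfl

open Classical in
/-- The end `K` of the cylinder. -/
def subdivisionInr (K : AbstractSimplicialComplex V) :
    SimplicialMap K (subdivisionCylinder K) where
  toFun := Sum.inr
  image_mem s hs := mem_subdivisionCylinder.2 ⟨nonempty_image _ (face_nonempty hs), by simp,
    by simp, fun _ => by
      convert hs
      ext; simp⟩

open Classical in
/-- The end `sd K` of the cylinder. -/
def subdivisionInl (K : AbstractSimplicialComplex V) :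
    SimplicialMap (orderComplex (FaceSpace K)) (subdivisionCylinder K) where
  toFun := Sum.inl
  image_mem c hc := by
    obtain ⟨h1, h2⟩ := mem_orderComplex_iff.1 hc
    refine mem_subdivisionCylinder.2 ⟨nonempty_image _ h1, fun s s' hs hs' => ?_, by simp,
      fun ⟨v, hv⟩ => by simp at hv⟩
    simp only [Finset.mem_image, Sum.inl.injEq, exists_eq_right] at hs hs'
    exact h2 s hs s' hs'

/-- The retraction of the cylinder. -/
noncomputable def subdivisionProj (K : AbstractSimplicialComplex V) :
    SimplicialMap (subdivisionCylinder K) K :=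
  .ofSubset (Sum.elim chosenVertex id) fun t ht => by
    classical
    obtain ⟨h1, h2, h3, h4⟩ := mem_subdivisionCylinder.1 ht
    by_cases hl : t.toLeft.Nonempty
    · obtain ⟨m, hm, h⟩ := exists_max_of_comparable hl fun a ha b hb =>
        h2 a b (Finset.mem_toLeft.1 ha) (Finset.mem_toLeft.1 hb)
      refine ⟨m.1, m.2, ?_⟩
      rintro (s | v) hv
      · exact FaceSpace.specializes_iff.1 (h s (Finset.mem_toLeft.2 hv)) (chosenVertex_mem s)
      · exact h3 m v (Finset.mem_toLeft.1 hm) hv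
    · refine ⟨t.toRight, h4 ?_, ?_⟩
      · obtain ⟨s | v, hv⟩ := h1
        · exact absurd ⟨s, Finset.mem_toLeft.2 hv⟩ hl
        · exact ⟨v, Finset.mem_toRight.2 hv⟩
      · rintro (s | v) hv
        · exact absurd ⟨s, Finset.mem_toLeft.2 hv⟩ hl
        · exact Finset.mem_toRight.2 hv

/-- Simplices `x`, viewed as vertices of the subdivision, are removed from the smallest up. If `x`
is minimal among those left, every other one in a cylinder simplex with `x` contains `x`, so the
chosen vertex of `x` can be added or deleted freely. -/
theorem isExpansion_subdivisionInr [Finite V] : IsExpansion (subdivisionInr K) := by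
  classical
  let N : Set (FaceSpace K) → PreAbstractSimplicialComplex (FaceSpace K ⊕ V) := fun T =>
    { faces := {t | t ∈ subdivisionCylinder K ∧ ∀ s, .inl s ∈ t → s ∈ T}
      isRelLowerSet_faces := fun t ht => ⟨face_nonempty ht.1, fun b hb hn =>
        ⟨face_of_subset ht.1 hb hn, fun s hs => ht.2 s (hb hs)⟩⟩ }
  have key : ∀ T, Collapses (N T) (N ∅) := by
    intro T
    induction T using WellFoundedLT.induction with
    | _ T ih =>
    rcases T.eq_empty_or_nonempty with rfl | hne
    · exact .refl
    obtain ⟨x, hx, hmin⟩ := exists_minimal_specializes hne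
    refine .trans ?_ (ih (T \ {x}) ⟨Set.sdiff_subset, fun h => (h hx).2 rfl⟩)
    refine collapses_of_toggle (fun t ht => ⟨ht.1, fun s hs => (ht.2 s hs).1⟩)
      (.inr (chosenVertex x)) fun t ht htx => ?_
    have hxt : Sum.inl x ∈ t := by
      by_contra hxt
      refine htx ⟨ht.1, fun s hs => ⟨ht.2 s hs, ?_⟩⟩
      rintro rfl
      exact hxt hs
    obtain ⟨h1, h2, h3, h4⟩ := mem_subdivisionCylinder.1 ht.1
    have hsub : ∀ s, Sum.inl s ∈ t → x.1 ⊆ s.1 := by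
      intro s hs
      rcases h2 s x hs hxt with h | h
      · rw [hmin s (ht.2 s hs) h]
      · exact FaceSpace.specializes_iff.1 h
    have hx' : Sum.inl x ∈ t.erase (.inr (chosenVertex x)) := by simpa using hxt
    refine ⟨⟨mem_subdivisionCylinder.2 ⟨Finset.insert_nonempty _ _, ?_, ?_, fun hr => ?_⟩, ?_⟩,
      ⟨face_of_subset ht.1 (Finset.erase_subset _ _) ⟨_, hx'⟩, fun s hs =>
        ht.2 s (Finset.mem_of_mem_erase hs)⟩, fun h => (h.2 x hx').2 rfl⟩
    · intro s s' hs hs'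
      exact h2 s s' (by simpa using hs) (by simpa using hs')
    · intro s v hs hv
      replace hs : Sum.inl s ∈ t := by simpa using hs
      rcases Finset.mem_insert.1 hv with hv | hv
      · rw [Sum.inr.inj hv]
        exact hsub s hs (chosenVertex_mem x)
      · exact h3 s v hs hv
    · refine face_of_subset x.2 (fun v hv => ?_) hr
      rcases Finset.mem_insert.1 (Finset.mem_toRight.1 hv) with hv | hv
      · rw [Sum.inr.inj hv]
        exact chosenVertex_mem x
      · exact h3 x v hxt hv
    · intro s hs
      exact ht.2 s (by simpa using hs)
  refine isExpansion_of_collapses (Q := N ∅) Sum.inr_injective (fun t => ⟨fun ht => ?_, ?_⟩) ?_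
  · refine ⟨t.toRight, (mem_subdivisionCylinder.1 ht.1).2.2.2 ?_, ?_⟩
    · obtain ⟨s | v, hv⟩ := face_nonempty ht.1
      · exact (ht.2 s hv).elim
      · exact ⟨v, Finset.mem_toRight.2 hv⟩
    · rintro (s | v)
      · exact ⟨fun h => (ht.2 s h).elim, by rintro ⟨v, -, h⟩; cases h⟩
      · simp [subdivisionInr]
  · rintro ⟨s, hs, ht⟩
    refine ⟨(subdivisionInr K).mem_of_image hs ht, fun s' hs' => ?_⟩
    obtain ⟨v, -, h⟩ := (ht _).1 hs'
    cases h
  · convert key Set.univ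
    exact PreAbstractSimplicialComplex.ext (Set.ext fun t =>
      ⟨fun h => ⟨h, fun _ _ => Set.mem_univ _⟩, fun h => h.1⟩)

/-- Here simplices of `K` are removed from the largest down. `N T` allows only vertex parts all of
whose faces lie in `T`; for `x` maximal in `T`, a vertex part containing `x` equals `x`, and the
barycenter of `x` can be added or deleted freely. -/
theorem isExpansion_subdivisionInl [Finite V] : IsExpansion (subdivisionInl K) := by
  classical
  let N : Set (FaceSpace K) → PreAbstractSimplicialComplex (FaceSpace K ⊕ V) := fun T =>
    { faces := {t | t ∈ subdivisionCylinder K ∧ ∀ s : FaceSpace K, s.1 ⊆ t.toRight → s ∈ T}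
      isRelLowerSet_faces := fun t ht => ⟨face_nonempty ht.1, fun b hb hn =>
        ⟨face_of_subset ht.1 hb hn, fun s hs =>
          ht.2 s (hs.trans (Finset.toRight_subset_toRight hb))⟩⟩ }
  have key : ∀ T, Collapses (N T) (N ∅) := by
    intro T
    induction T using WellFoundedLT.induction with
    | _ T ih =>
    rcases T.eq_empty_or_nonempty with rfl | hne
    · exact .refl
    obtain ⟨x, hx, hmax⟩ := exists_maximal_specializes hne
    refine .trans ?_ (ih (T \ {x}) ⟨Set.sdiff_subset, fun h => (h hx).2 rfl⟩)
    refine collapses_of_toggle (fun t ht => ⟨ht.1, fun s hs => (ht.2 s hs).1⟩)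
      (.inl x) fun t ht htx => ?_
    obtain ⟨h1, h2, h3, h4⟩ := mem_subdivisionCylinder.1 ht.1
    have hxt : x.1 ⊆ t.toRight := by
      by_contra hxt
      refine htx ⟨ht.1, fun s hs => ⟨ht.2 s hs, ?_⟩⟩
      rintro rfl
      exact hxt hs
    have htK := h4 ((face_nonempty x.2).mono hxt)
    have hxt' : t.toRight = x.1 := by
      have := hmax ⟨t.toRight, htK⟩ (ht.2 _ subset_rfl) (FaceSpace.specializes_iff.2 hxt)
      exact congrArg Subtype.val this
    have hsub : ∀ s, Sum.inl s ∈ t → Comparable x s := fun s hs =>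
      .inl (FaceSpace.specializes_iff.2 fun v hv => h3 s v hs (Finset.mem_toRight.1 (hxt hv)))
    have hins : (insert (.inl x) t : Finset (FaceSpace K ⊕ V)).toRight = t.toRight := by
      ext; simp
    have her : (t.erase (.inl x) : Finset (FaceSpace K ⊕ V)).toRight = t.toRight := by
      ext; simp
    refine ⟨⟨mem_subdivisionCylinder.2 ⟨Finset.insert_nonempty _ _, ?_, ?_, fun hr => ?_⟩, ?_⟩,
      ⟨face_of_subset ht.1 (Finset.erase_subset _ _) ?_, fun s hs => ht.2 s (by rwa [her] at hs)⟩,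
      fun h => (h.2 x (by rwa [her])).2 rfl⟩
    · intro s s' hs hs'
      rcases Finset.mem_insert.1 hs with hs | hs <;> rcases Finset.mem_insert.1 hs' with hs' | hs'
      · rw [Sum.inl.inj hs, Sum.inl.inj hs']
        exact .inl specializes_rfl
      · rw [Sum.inl.inj hs]
        exact hsub _ hs'
      · rw [Sum.inl.inj hs']
        exact (hsub _ hs).symm
      · exact h2 s s' hs hs'
    · intro s v hs hv
      replace hv : Sum.inr v ∈ t := by simpa using hv
      rcases Finset.mem_insert.1 hs with hs | hs
      · rw [Sum.inl.inj hs, ← hxt']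
        exact Finset.mem_toRight.2 hv
      · exact h3 s v hs hv
    · rwa [hins]
    · intro s hs
      exact ht.2 s (by rwa [hins] at hs)
    · obtain ⟨v, hv⟩ := face_nonempty x.2
      exact ⟨.inr v, by simpa using Finset.mem_toRight.1 (hxt hv)⟩
  have hempty : ∀ t ∈ N ∅, ∀ v, Sum.inr v ∉ t := by
    intro t ht v hv
    have hr : t.toRight.Nonempty := ⟨v, Finset.mem_toRight.2 hv⟩
    exact ht.2 ⟨t.toRight, (mem_subdivisionCylinder.1 ht.1).2.2.2 hr⟩ subset_rfl
  refine isExpansion_of_collapses (Q := N ∅) Sum.inl_injective (fun t => ⟨fun ht => ?_, ?_⟩) ?_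
  · refine ⟨t.toLeft, mem_orderComplex_iff.2 ⟨?_, fun a ha b hb => ?_⟩, ?_⟩
    · obtain ⟨s | v, hv⟩ := face_nonempty ht.1
      · exact ⟨s, Finset.mem_toLeft.2 hv⟩
      · exact (hempty t ht v hv).elim
    · exact (mem_subdivisionCylinder.1 ht.1).2.1 a b (Finset.mem_toLeft.1 ha)
        (Finset.mem_toLeft.1 hb)
    · rintro (s | v)
      · simp [subdivisionInl]
      · exact ⟨fun h => (hempty t ht v h).elim, by rintro ⟨v, -, h⟩; cases h⟩
  · rintro ⟨s, hs, ht⟩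
    refine ⟨(subdivisionInl K).mem_of_image hs ht, fun s' hs' => ?_⟩
    obtain ⟨v, hv⟩ := face_nonempty s'.2
    obtain ⟨w, -, h⟩ := (ht _).1 (Finset.mem_toRight.1 (hs' hv))
    cases h
  · convert key Set.univ
    exact PreAbstractSimplicialComplex.ext (Set.ext fun t =>
      ⟨fun h => ⟨h, fun _ _ => Set.mem_univ _⟩, fun h => h.1⟩)

theorem isSimpleHomotopyEquiv_subdivisionMap [Fintype V] :
    IsSimpleHomotopyEquiv (subdivisionMap K).realization :=
  isSimpleHomotopyEquiv_of_cylinder (subdivisionProj K) isExpansion_subdivisionInl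
    isExpansion_subdivisionInr (fun _ => rfl) fun _ => rfl

/-- In the naturality square of the subdivision maps, three sides are simple homotopy equivalences,
hence so is the fourth. -/
theorem isSimpleHomotopyEquiv_of_inDBar_faceSpaceMap [Fintype V] [Fintype W]
    {φ : SimplicialMap K L} (h : InDBar (faceSpaceMap φ)) :
    IsSimpleHomotopyEquiv φ.realization := by
  refine .of_comp_left (isSimpleHomotopyEquiv_subdivisionMap (K := K)) ?_
  have h1 := (subdivisionMap_natural φ).homotopic
  rw [realization_comp, realization_comp] at h1
  exact (isSimpleHomotopyEquiv_subdivisionMap.comp h.isSimpleHomotopyEquiv).congr h1.symm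

end Barycentric

/-! ### Simplicial maps and the class generated by the distinguished maps -/

section FacePosets

variable {V W Z : Type u} {K : AbstractSimplicialComplex V} {L : AbstractSimplicialComplex W}
  {M : AbstractSimplicialComplex Z}

instance [Finite V] : AlexandrovDiscrete (FaceSpace K) := Finite.toAlexandrovDiscrete

theorem faceSpaceMap_comp (ψ : SimplicialMap L M) (φ : SimplicialMap K L) :
    faceSpaceMap (ψ.comp φ) = (faceSpaceMap ψ).comp (faceSpaceMap φ) := by
  classical
  ext1 s
  exact Subtype.ext (Finset.image_image (s := s.1) (f := φ.toFun) (g := ψ.toFun)).symm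

open Classical in
theorem Contiguous.faceSpaceMap_homotopic [Finite V] {φ ψ : SimplicialMap K L}
    (h : Contiguous φ ψ) : (faceSpaceMap φ).Homotopic (faceSpaceMap ψ) := by
  -- Contiguity makes `s ↦ φ(s) ∪ ψ(s)` a common upper bound of the two face maps.
  let u : C(FaceSpace K, FaceSpace L) :=
    ⟨fun s => ⟨s.1.image φ.toFun ∪ s.1.image ψ.toFun, h s.1 s.2⟩,
      continuous_of_specializes fun s t hst => FaceSpace.specializes_iff.2
        (Finset.union_subset_union (Finset.image_subset_image (FaceSpace.specializes_iff.1 hst))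
          (Finset.image_subset_image (FaceSpace.specializes_iff.1 hst)))⟩
  have h1 : (faceSpaceMap φ).Homotopic u := homotopic_of_specializes fun s =>
    FaceSpace.specializes_iff.2 Finset.subset_union_left
  have h2 : (faceSpaceMap ψ).Homotopic u := homotopic_of_specializes fun s =>
    FaceSpace.specializes_iff.2 Finset.subset_union_right
  exact h1.trans h2.symm

theorem Contiguous.inDBar_iff [Finite V] [Finite W] {φ ψ : SimplicialMap K L}
    (h : Contiguous φ ψ) : InDBar (faceSpaceMap φ) ↔ InDBar (faceSpaceMap ψ) :=
  ⟨fun h1 => h1.congr h.faceSpaceMap_homotopic, fun h1 => h1.congr h.faceSpaceMap_homotopic.symm⟩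

/-! ### The maximum of a chain: from `X(K(X))` back to `X` -/

section ChainMax

variable {X Y : Type u} [TopologicalSpace X] [TopologicalSpace Y]

theorem exists_max_of_chain (c : FaceSpace (orderComplex X)) : ∃ m ∈ c.1, ∀ x ∈ c.1, x ⤳ m := by
  obtain ⟨h1, h2⟩ := mem_orderComplex_iff.1 c.2
  exact exists_max_of_comparable h1 h2

variable [Finite X] [Finite Y]

/-- The map which sends a chain to its maximum. -/
noncomputable def chainMax (X : Type u) [TopologicalSpace X] [Finite X] :
    C(FaceSpace (orderComplex X), X) where
  toFun c := (exists_max_of_chain c).choose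
  continuous_toFun := continuous_of_specializes fun c d hcd =>
    (exists_max_of_chain d).choose_spec.2 _
      (FaceSpace.specializes_iff.1 hcd (exists_max_of_chain c).choose_spec.1)

theorem chainMax_mem (c : FaceSpace (orderComplex X)) : chainMax X c ∈ c.1 :=
  (exists_max_of_chain c).choose_spec.1

theorem specializes_chainMax (c : FaceSpace (orderComplex X)) {x : X} (hx : x ∈ c.1) :
    x ⤳ chainMax X c :=
  (exists_max_of_chain c).choose_spec.2 x hx

/-- The preimage of `U_y` consists of the chains in `U_y`, and it is contracted by the fence `c ≤ c
∪ {y} ≥ {y}`. -/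
theorem isDistinguished_chainMax : IsDistinguished (chainMax X) := by
  classical
  refine isDistinguished_iff.2 fun y => ?_
  have hle : ∀ c : {c // chainMax X c ⤳ y}, ∀ x ∈ c.1.1, x ⤳ y := fun c x hx =>
    (specializes_chainMax c.1 hx).trans c.2
  have hmem : ∀ c : {c // chainMax X c ⤳ y}, insert y c.1.1 ∈ orderComplex X := fun c => by
    refine mem_orderComplex_iff.2 ⟨Finset.insert_nonempty _ _, fun a ha b hb => ?_⟩
    rcases Finset.mem_insert.1 ha with rfl | ha' <;> rcases Finset.mem_insert.1 hb with rfl | hb'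
    · exact .inl specializes_rfl
    · exact .inr (hle c b hb')
    · exact .inl (hle c a ha')
    · exact (mem_orderComplex_iff.1 c.1.2).2 a ha' b hb'
  let g : C({c // chainMax X c ⤳ y}, {c // chainMax X c ⤳ y}) :=
    ⟨fun c => ⟨⟨insert y c.1.1, hmem c⟩, by
        rcases Finset.mem_insert.1 (chainMax_mem ⟨insert y c.1.1, hmem c⟩) with h | h
        · rw [h]
        · exact hle c _ h⟩,
      continuous_of_specializes fun c d hcd => subtype_specializes_iff.2
        (FaceSpace.specializes_iff.2 (Finset.insert_subset_insert _
          (FaceSpace.specializes_iff.1 (subtype_specializes_iff.1 hcd))))⟩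
  have hy : {y} ∈ orderComplex X := (orderComplex X).singleton_mem y
  refine contractibleSpace_of_fence g ⟨⟨{y}, hy⟩, ?_⟩ (fun c => ?_) fun c => ?_
  · rw [Finset.mem_singleton.1 (chainMax_mem ⟨{y}, hy⟩)]
  · exact subtype_specializes_iff.2 (FaceSpace.specializes_iff.2 (Finset.subset_insert _ _))
  · exact subtype_specializes_iff.2 (FaceSpace.specializes_iff.2
      (Finset.singleton_subset_iff.2 (Finset.mem_insert_self _ _)))

theorem chainMax_natural (f : C(X, Y)) : (f.comp (chainMax X)).Homotopic
    ((chainMax Y).comp (faceSpaceMap (orderComplexMap f))) := by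
  classical
  refine homotopic_of_specializes fun c => ?_
  exact specializes_chainMax (faceSpaceMap (orderComplexMap f) c)
    (Finset.mem_image_of_mem f (chainMax_mem c))

theorem inDBar_iff_faceSpaceMap_orderComplexMap [T0Space X] [T0Space Y] (f : C(X, Y)) :
    InDBar f ↔ InDBar (faceSpaceMap (orderComplexMap f)) := by
  have hX : InDBar (chainMax X) := .of_isDistinguished isDistinguished_chainMax
  have hY : InDBar (chainMax Y) := .of_isDistinguished isDistinguished_chainMax
  exact ⟨fun h => .of_comp_right hY ((h.comp hX).congr (chainMax_natural f)),
    fun h => .of_comp_left hX ((hY.comp h).congr (chainMax_natural f).symm)⟩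

end ChainMax

/-- The chosen vertices of the members of a chain all lie in its largest member, so this face map is
bounded above by the distinguished map `chainMax`. -/
theorem inDBar_subdivisionMap [Finite V] : InDBar (faceSpaceMap (subdivisionMap K)) := by
  classical
  have h : InDBar (chainMax (FaceSpace K)) := .of_isDistinguished isDistinguished_chainMax
  refine h.congr (.symm (homotopic_of_specializes fun c => FaceSpace.specializes_iff.2 ?_))
  refine Finset.image_subset_iff.2 fun s hs => ?_
  exact FaceSpace.specializes_iff.1 (specializes_chainMax c hs) (chosenVertex_mem s)

/-- The inclusion of the poset of simplices of a subcomplex. -/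
def subcomplexInclusion (K : AbstractSimplicialComplex V) (P : PreAbstractSimplicialComplex V) :
    C({T : FaceSpace K // T.1 ∈ P}, FaceSpace K) :=
  ⟨Subtype.val, continuous_subtype_val⟩

theorem sub_specializes_iff {p : FaceSpace K → Prop} {S T : Subtype p} :
    S ⤳ T ↔ S.1.1 ⊆ T.1.1 :=
  subtype_specializes_iff.trans FaceSpace.specializes_iff

/-- The simplices `S` and `aS` are deleted one at a time from the face poset. Since `aS` is the only
simplex properly containing `S`, sending `S` to `aS` is left adjoint to the inclusion of the poset
`B` without `S`. From `B`, deleting `aS` is harmless because the faces below it form the cone `a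
∂S`. -/
theorem inDBar_inclusion_of_elementaryCollapse [Finite V] {P Q : PreAbstractSimplicialComplex V}
    (hP : ∀ t ∈ P, t ∈ K) (h : ElementaryCollapse P Q) (hQP : ∀ t ∈ Q, t ∈ P) :
    InDBar (⟨fun T => ⟨T.1, hQP _ T.2⟩, by fun_prop⟩ :
      C({T : FaceSpace K // T.1 ∈ Q}, {T : FaceSpace K // T.1 ∈ P})) := by
  classical
  obtain ⟨S, a, hSn, haS, -, haP, hSP, hPQ, hQS, hSQ⟩ := elementaryCollapse_data h
  have hne : insert a S ≠ S := fun h => haS (h ▸ Finset.mem_insert_self a S)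
  have hup : ∀ t ∈ P, S ⊆ t → t ≠ S → t = insert a S := by
    intro t ht hSt htS
    rcases hPQ t ht with hQ | hta
    · exact absurd hSt (hQS t hQ)
    · refine hta.antisymm (Finset.insert_subset ?_ hSt)
      obtain ⟨v, hv, hvS⟩ := Finset.exists_of_ssubset (hSt.ssubset_of_ne (Ne.symm htS))
      rcases Finset.mem_insert.1 (hta hv) with rfl | h
      · exact hv
      · exact absurd h hvS
  let B := {T : FaceSpace K // T.1 ∈ P ∧ T.1 ≠ S}
  let top : B := ⟨⟨insert a S, hP _ haP⟩, haP, hne⟩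
  let r : C({T : FaceSpace K // T.1 ∈ P}, B) :=
    ⟨fun T => if hT : T.1.1 = S then top else ⟨T.1, T.2, hT⟩,
      continuous_of_specializes fun T T' hTT' => by
        rw [sub_specializes_iff] at hTT' ⊢
        by_cases h1 : T.1.1 = S <;> by_cases h2 : T'.1.1 = S
        · simp [h1, h2]
        · simp only [h1, h2, dite_true, dite_false]
          exact (hup _ T'.2 (h1 ▸ hTT') h2).ge
        · simp only [h1, h2, dite_true, dite_false]
          exact (hTT'.trans h2.le).trans (Finset.subset_insert _ _)
        · simpa only [h1, h2, dite_true, dite_false] using hTT'⟩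
  have hr : InDBar r := by
    refine .of_adjoint (fun T => ⟨T.1, T.2.1⟩) fun T T' => ?_
    rw [sub_specializes_iff, sub_specializes_iff]
    by_cases h1 : T.1.1 = S
    · have : r T = top := dif_pos h1
      rw [this, h1]
      refine ⟨fun h => (Finset.subset_insert a S).trans h, fun h => ?_⟩
      exact (hup _ T'.2.1 h T'.2.2).ge
    · have : r T = ⟨T.1, T.2, h1⟩ := dif_neg h1
      rw [this]
  let k : C({T : FaceSpace K // T.1 ∈ Q}, B) :=
    ⟨fun T => ⟨T.1, hQP _ T.2, fun hT => hQS _ T.2 hT.ge⟩, by fun_prop⟩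
  have hk : InDBar k := by
    refine .of_isDistinguished (isDistinguished_iff.2 fun T => ?_)
    by_cases hT : T.1.1 ∈ Q
    · refine contractibleSpace_of_forall_specializes ⟨⟨T.1, hT⟩, ?_⟩ fun T' => ?_
      · exact sub_specializes_iff.2 subset_rfl
      · exact subtype_specializes_iff.2 (sub_specializes_iff.2 (sub_specializes_iff (S := k T'.1) (T := T).1 T'.2))
    · have hTa : T.1.1 = insert a S := by
        rcases hPQ _ T.2.1 with hQ | hta
        · exact absurd hQ hT
        · refine hup _ T.2.1 ?_ T.2.2
          by_contra hS
          exact hT (hSQ _ (face_nonempty T.1.2) hta hS)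
      have hin : ∀ t ∈ Q, t ⊆ insert a S → insert a t ∈ Q := by
        intro t ht hta
        refine hSQ _ (Finset.insert_nonempty _ _)
          (Finset.insert_subset (Finset.mem_insert_self _ _) hta) fun hS => hQS t ht fun v hv => ?_
        rcases Finset.mem_insert.1 (hS hv) with rfl | h
        · exact absurd hv haS
        · exact h
      have haQ : {a} ∈ Q := by
        refine hSQ _ (Finset.singleton_nonempty a) (by simp) fun hS => ?_
        obtain ⟨v, hv⟩ := hSn
        exact haS (Finset.mem_singleton.1 (hS hv) ▸ hv)
      have hsub : ∀ T' : {T' // k T' ⤳ T}, T'.1.1.1 ⊆ insert a S := fun T' =>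
        hTa ▸ sub_specializes_iff.1 T'.2
      -- The cone is contracted to its apex by the fence `t ≤ t ∪ {a} ≥ {a}`.
      let g : C({T' // k T' ⤳ T}, {T' // k T' ⤳ T}) :=
        ⟨fun T' => ⟨⟨⟨insert a T'.1.1.1, hP _ (hQP _ (hin _ T'.1.2 (hsub T')))⟩,
            hin _ T'.1.2 (hsub T')⟩, sub_specializes_iff.2 (by
              rw [hTa]
              exact Finset.insert_subset (Finset.mem_insert_self _ _) (hsub T'))⟩,
          continuous_of_specializes fun T₁ T₂ h12 => by
            rw [subtype_specializes_iff, sub_specializes_iff] at h12 ⊢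
            exact Finset.insert_subset_insert _ h12⟩
      refine contractibleSpace_of_fence g ⟨⟨⟨{a}, hP _ (hQP _ haQ)⟩, haQ⟩, ?_⟩ (fun T' => ?_)
        fun T' => ?_
      · refine sub_specializes_iff.2 ?_
        rw [hTa]
        exact Finset.singleton_subset_iff.2 (Finset.mem_insert_self _ _)
      · exact subtype_specializes_iff.2 (sub_specializes_iff.2 (Finset.subset_insert _ _))
      · exact subtype_specializes_iff.2 (sub_specializes_iff.2
          (Finset.singleton_subset_iff.2 (Finset.mem_insert_self _ _)))
  refine .of_comp_right hr ?_
  have : r.comp ⟨fun T : {T : FaceSpace K // T.1 ∈ Q} => ⟨T.1, hQP _ T.2⟩, by fun_prop⟩ = k := by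
    ext1 T
    exact dif_neg fun hT => hQS _ T.2 hT.ge
  rw [this]
  exact hk

theorem inDBar_subcomplexInclusion [Finite V] {P : PreAbstractSimplicialComplex V}
    (h : Collapses K.toPreAbstractSimplicialComplex P) : InDBar (subcomplexInclusion K P) := by
  induction h with
  | refl =>
    refine .of_adjoint (fun T => ⟨T, T.2⟩) fun T T' => ?_
    rw [sub_specializes_iff, FaceSpace.specializes_iff]
    rfl
  | @tail P Q hKP h ih =>
    obtain ⟨-, -, -, -, hQP, -⟩ := elementaryCollapse_data h
    exact ih.comp (inDBar_inclusion_of_elementaryCollapse (collapses_le hKP) h hQP)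

/-- The face map is an isomorphism onto the face poset of the image followed by an inclusion
obtained from collapses. -/
theorem IsExpansion.inDBar [Finite V] [Finite W] {i : SimplicialMap L K} (hi : IsExpansion i) :
    InDBar (faceSpaceMap i) := by
  classical
  have hP := inDBar_subcomplexInclusion hi.2
  let P := L.toPreAbstractSimplicialComplex.map i.toFun
  let e : C(FaceSpace L, {T : FaceSpace K // T.1 ∈ P}) :=
    ⟨fun S => ⟨faceSpaceMap i S, S.1, S.2, rfl⟩, by fun_prop⟩
  have he : InDBar e := by
    have hex : ∀ T : {T : FaceSpace K // T.1 ∈ P}, ∃ s ∈ L, s.image i.toFun = T.1.1 :=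
      fun T => T.2
    choose f hfL hf using hex
    refine .of_adjoint (fun T => ⟨f T, hfL T⟩) fun S T => ?_
    refine sub_specializes_iff.trans (Iff.trans ?_ FaceSpace.specializes_iff.symm)
    rw [← hf T]
    exact Finset.image_subset_image_iff hi.1
  exact hP.comp he

end FacePosets

/-! ### Simplicial approximation -/

section Mesh

/-- In the average of the differences `f a - f b`, the term `b = a` vanishes. This saves the
fraction `1 / t.card` and produces the contraction of the mesh under subdivision. -/
theorem abs_sub_average_le {ι : Type*} {t : Finset ι} {f : ι → ℝ} {D : ℝ}
    (h : ∀ a ∈ t, ∀ b ∈ t, |f a - f b| ≤ D) {a : ι} (ha : a ∈ t) :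
    |f a - (∑ b ∈ t, f b) / t.card| ≤ (1 - 1 / t.card) * D := by
  classical
  have hc : (0 : ℝ) < t.card := by exact_mod_cast Finset.card_pos.2 ⟨a, ha⟩
  have h1 : f a - (∑ b ∈ t, f b) / t.card = (∑ b ∈ t.erase a, (f a - f b)) / t.card := by
    have : ∑ b ∈ t.erase a, (f a - f b) = ∑ b ∈ t, (f a - f b) := by
      rw [← Finset.add_sum_erase _ _ ha]; simp
    rw [this, Finset.sum_sub_distrib, Finset.sum_const, nsmul_eq_mul]
    field_simp
  rw [h1, abs_div, abs_of_pos hc, div_le_iff₀ hc]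
  calc |∑ b ∈ t.erase a, (f a - f b)| ≤ ∑ b ∈ t.erase a, |f a - f b| :=
        Finset.abs_sum_le_sum_abs _ _
    _ ≤ ∑ b ∈ t.erase a, D := Finset.sum_le_sum fun b hb => h a ha b (Finset.mem_of_mem_erase hb)
    _ = (1 - 1 / t.card) * D * t.card := by
        rw [Finset.sum_const, nsmul_eq_mul, Finset.card_erase_of_mem ha,
          Nat.cast_sub (Finset.card_pos.2 ⟨a, ha⟩)]
        field_simp
        ring

theorem abs_average_sub_average_le {ι : Type*} {s t : Finset ι} (hst : s ⊆ t) (hs : s.Nonempty)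
    {f : ι → ℝ} {D : ℝ} (h : ∀ a ∈ t, ∀ b ∈ t, |f a - f b| ≤ D) :
    |(∑ a ∈ s, f a) / s.card - (∑ b ∈ t, f b) / t.card| ≤ (1 - 1 / t.card) * D := by
  have hc : (0 : ℝ) < s.card := by exact_mod_cast Finset.card_pos.2 hs
  have h1 : (∑ a ∈ s, f a) / s.card - (∑ b ∈ t, f b) / t.card =
      (∑ a ∈ s, (f a - (∑ b ∈ t, f b) / t.card)) / s.card := by
    rw [Finset.sum_sub_distrib, Finset.sum_const, nsmul_eq_mul]
    field_simp
  rw [h1, abs_div, abs_of_pos hc, div_le_iff₀ hc, mul_comm]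
  refine (Finset.abs_sum_le_sum_abs _ _).trans ?_
  rw [← nsmul_eq_mul, ← Finset.sum_const]
  exact Finset.sum_le_sum fun a ha => abs_sub_average_le h (hst ha)

variable {V : Type u} [Fintype V]

/-- Iterated barycentric subdivisions, given with the positions `p` of their vertices. -/
theorem exists_fine_subdivision (K : AbstractSimplicialComplex V) (n : ℕ) :
    ∃ (V' : Type u) (_ : Fintype V') (K' : AbstractSimplicialComplex V')
      (τ : SimplicialMap K' K) (p : V' → V → ℝ), InDBar (faceSpaceMap τ) ∧
      (∀ c ∈ K', c.card ≤ Fintype.card V) ∧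
      (∀ c ∈ K', ∃ s ∈ K, ∀ w ∈ c, τ.toFun w ∈ s ∧ ∀ v, p w v ≠ 0 → v ∈ s) ∧
      (∀ w v, 0 ≤ p w v) ∧ (∀ w, ∑ v, p w v = 1) ∧
      ∀ c ∈ K', ∀ w ∈ c, ∀ w' ∈ c, ∀ v,
        |p w v - p w' v| ≤ (1 - 1 / ((Fintype.card V : ℝ) + 1)) ^ n := by
  classical
  induction n with
  | zero =>
    refine ⟨V, inferInstance, K, .id K, fun w v => if v = w then 1 else 0, ?_,
      fun c _ => Finset.card_le_univ c, fun c hc => ⟨c, hc, fun w hw => ⟨hw, fun v hv => ?_⟩⟩,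
      fun w v => ?_, fun w => by simp, fun c _ w _ w' _ v => ?_⟩
    · have : faceSpaceMap (SimplicialMap.id K) = ContinuousMap.id _ := by
        ext1 s
        exact Subtype.ext (Finset.image_id (s := s.1))
      rw [this]
      exact .id
    · have : v = w := by by_contra h; simp [h] at hv
      rwa [this]
    · dsimp only
      split_ifs <;> norm_num
    · dsimp only
      split_ifs <;> norm_num
  | succ n ih =>
    obtain ⟨V', _, K', τ, p, hτ, hcard, hcar, hp0, hp1, hmesh⟩ := ih
    have hpos : ∀ s : FaceSpace K', (0 : ℝ) < s.1.card := fun s => by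
      exact_mod_cast Finset.card_pos.2 (face_nonempty s.2)
    refine ⟨FaceSpace K', inferInstance, orderComplex (FaceSpace K'), τ.comp (subdivisionMap K'),
      fun s v => (∑ w ∈ s.1, p w v) / s.1.card, ?_, fun c hc => ?_, fun c hc => ?_,
      fun s v => div_nonneg (Finset.sum_nonneg fun w _ => hp0 w v) (Nat.cast_nonneg _),
      fun s => ?_, fun c hc s hs t ht v => ?_⟩
    · rw [faceSpaceMap_comp]
      exact hτ.comp inDBar_subdivisionMap
    · have h2 := (mem_orderComplex_iff.1 hc).2
      -- The members of a chain have distinct sizes between `1` and `card V`, so subdividing does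
      -- not raise the bound on the size of simplices.
      have : c.card ≤ (Finset.Icc 1 (Fintype.card V)).card := by
        refine Finset.card_le_card_of_injOn (fun s => s.1.card) (fun s _ => ?_) fun s hs t ht h => ?_
        · exact Finset.mem_coe.2 (Finset.mem_Icc.2
            ⟨Finset.card_pos.2 (face_nonempty s.2), hcard s.1 s.2⟩)
        · rcases h2 s hs t ht with h3 | h3
          · exact Subtype.ext (Finset.eq_of_subset_of_card_le (FaceSpace.specializes_iff.1 h3) h.ge)
          · exact (Subtype.ext (Finset.eq_of_subset_of_card_le (FaceSpace.specializes_iff.1 h3)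
              h.le)).symm
      simpa using this
    · obtain ⟨m, -, hm⟩ := exists_face_of_chain hc
      obtain ⟨s, hs, h⟩ := hcar m.1 m.2
      refine ⟨s, hs, fun t ht => ⟨(h _ (hm t ht (chosenVertex_mem t))).1, fun v hv => ?_⟩⟩
      obtain ⟨w, hw, hne⟩ := Finset.exists_ne_zero_of_sum_ne_zero (div_ne_zero_iff.1 hv).1
      exact (h w (hm t ht hw)).2 v hne
    · rw [← Finset.sum_div, Finset.sum_comm, Finset.sum_congr rfl fun w _ => hp1 w,
        Finset.sum_const, nsmul_eq_mul, mul_one, div_self (hpos s).ne']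
    · have key : ∀ s t : FaceSpace K', s ⤳ t →
          |(∑ w ∈ s.1, p w v) / s.1.card - (∑ w ∈ t.1, p w v) / t.1.card| ≤
            (1 - 1 / ((Fintype.card V : ℝ) + 1)) ^ (n + 1) := by
        intro s t hst
        refine (abs_average_sub_average_le (FaceSpace.specializes_iff.1 hst) (face_nonempty s.2)
          fun a ha b hb => hmesh t.1 t.2 a ha b hb v).trans ?_
        rw [pow_succ']
        -- The contraction rate uses `card V + 1` in place of `card V`, which keeps it below one
        -- even when `V` is empty.
        have h1 : (t.1.card : ℝ) ≤ Fintype.card V + 1 := by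
          have : (t.1.card : ℝ) ≤ Fintype.card V := by exact_mod_cast hcard t.1 t.2
          linarith
        have h2 : (0 : ℝ) ≤ 1 - 1 / ((Fintype.card V : ℝ) + 1) := by
          rw [sub_nonneg, div_le_one (by positivity)]
          linarith [Nat.cast_nonneg (α := ℝ) (Fintype.card V)]
        exact mul_le_mul_of_nonneg_right
          (sub_le_sub_left (one_div_le_one_div_of_le (hpos t) h1) 1) (pow_nonneg h2 n)
      rcases (mem_orderComplex_iff.1 hc).2 s hs t ht with h | h
      · exact key s t h
      · rw [abs_sub_comm]
        exact key t s h

end Mesh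

/-! ### Simplicial approximation of maps and homotopies -/

section Approximation

variable {V W : Type u} [Fintype V] [Fintype W] {K : AbstractSimplicialComplex V}
  {Z : AbstractSimplicialComplex W}

/-- Simultaneous simplicial approximations of the maps in a homotopy. -/
theorem exists_simplicial_approximation (H : C(I × Realization K, Realization Z)) :
    ∃ (V' : Type u) (_ : Fintype V') (K' : AbstractSimplicialComplex V')
      (τ : SimplicialMap K' K) (b : C(Realization K', Realization K)) (δ : ℝ)
      (ψ : I → SimplicialMap K' Z), 0 < δ ∧ InDBar (faceSpaceMap τ) ∧
      (∀ c ∈ K', ∃ s ∈ K, (∀ w ∈ c, τ.toFun w ∈ s) ∧ ∀ y, Carried y c → Carried (b y) s) ∧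
      ∀ t t' : I, dist t' t < δ → ∀ (y : Realization K') (w : V'), y.1 w ≠ 0 →
        (H (t', b y)).1 ((ψ t).toFun w) ≠ 0 := by
  classical
  -- The cover consists of the preimages under `H` of the open stars of the vertices of `Z`.
  obtain ⟨δ, hδ, hball⟩ := lebesgue_number_lemma_of_metric
    (s := (Set.univ : Set (I × Realization K))) (c := fun z : W => {p | (H p).1 z ≠ 0})
    isCompact_univ
    (fun z => isOpen_ne_fun ((continuous_coord z).comp H.continuous) continuous_const)
    (fun p _ => by
      have : ∑ z, (H p).1 z ≠ 0 := by rw [realization_sum]; exact one_ne_zero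
      obtain ⟨z, -, hz⟩ := Finset.exists_ne_zero_of_sum_ne_zero this
      exact Set.mem_iUnion.2 ⟨z, hz⟩)
  obtain ⟨n, hn⟩ := exists_pow_lt_of_lt_one hδ
    (show 1 - 1 / ((Fintype.card V : ℝ) + 1) < 1 from sub_lt_self _ (by positivity))
  obtain ⟨V', _, K', τ, p, hτ, -, hcar, hp0, hp1, hmesh⟩ := exists_fine_subdivision K n
  have hsupp : ∀ (y : Realization K') (c : Finset V') (s : Finset V), Carried y c →
      (∀ w ∈ c, ∀ v, p w v ≠ 0 → v ∈ s) → ∀ v, ∑ w, y.1 w * p w v ≠ 0 → v ∈ s := by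
    intro y c s hy hs v hv
    obtain ⟨w, -, hw⟩ := Finset.exists_ne_zero_of_sum_ne_zero hv
    exact hs w (hy w (left_ne_zero_of_mul hw)) v (right_ne_zero_of_mul hw)
  -- This is the affine extension of the vertex positions. Only its carriers and the mesh bound
  -- matter; it need not be known to be a homeomorphism.
  let b : C(Realization K', Realization K) := ofCoords (fun y v => ∑ w, y.1 w * p w v)
    (fun v => continuous_finsetSum _ fun w _ => (continuous_coord w).mul continuous_const)
    (fun y v => Finset.sum_nonneg fun w _ => mul_nonneg (realization_nonneg y w) (hp0 w v))
    (fun y => by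
      rw [Finset.sum_comm]
      simp_rw [← Finset.mul_sum, hp1, mul_one]
      exact realization_sum y)
    (fun y => by
      obtain ⟨c, hc, hy⟩ := exists_carried y
      obtain ⟨s, hs, h⟩ := hcar c hc
      exact ⟨s, hs, hsupp y c s hy fun w hw => (h w hw).2⟩)
  have hdist : ∀ (y : Realization K') (w : V'), y.1 w ≠ 0 →
      dist (b y) (b (vertexPoint K' w)) < δ := by
    intro y w hw
    obtain ⟨c, hc, hy⟩ := exists_carried y
    refine (dist_pi_lt_iff hδ).2 fun v => ?_
    rw [Real.dist_eq]
    change |∑ w', y.1 w' * p w' v - ∑ w', (Pi.single w 1 : V' → ℝ) w' * p w' v| < δ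
    have h1 : ∑ w', (Pi.single w 1 : V' → ℝ) w' * p w' v = ∑ w', y.1 w' * p w v := by
      rw [← Finset.sum_mul, realization_sum]
      simp [Pi.single_apply]
    rw [h1, ← Finset.sum_sub_distrib]
    refine ((Finset.abs_sum_le_sum_abs _ _).trans ?_).trans_lt hn
    calc ∑ w', |y.1 w' * p w' v - y.1 w' * p w v|
        ≤ ∑ w', y.1 w' * (1 - 1 / ((Fintype.card V : ℝ) + 1)) ^ n := by
          refine Finset.sum_le_sum fun w' _ => ?_
          rw [← mul_sub, abs_mul, abs_of_nonneg (realization_nonneg y w')]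
          by_cases h0 : y.1 w' = 0
          · simp [h0]
          · exact mul_le_mul_of_nonneg_left (hmesh c hc w' (hy w' h0) w (hy w hw) v)
              (realization_nonneg y w')
      _ = _ := by rw [← Finset.sum_mul, realization_sum, one_mul]
  -- The vertex `f t w` is one whose open star has a preimage containing the `δ`-ball around `(t, b
  -- w)`. That ball contains `(t', b y)` for `t'` near `t` and every `y` with nonzero coordinate at
  -- `w`.
  choose f hf using fun (t : I) (w : V') => hball (t, b (vertexPoint K' w)) (Set.mem_univ _)
  have hψ : ∀ t t' : I, dist t' t < δ → ∀ (y : Realization K') (w : V'), y.1 w ≠ 0 →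
      (H (t', b y)).1 (f t w) ≠ 0 := fun t t' ht y w hw =>
    hf t w (show (t', b y) ∈ Metric.ball _ _ from by
      rw [Metric.mem_ball, Prod.dist_eq]
      exact max_lt ht (hdist y w hw))
  refine ⟨V', inferInstance, K', τ, b, δ, fun t => .ofSubset (f t) fun c hc => ?_, hδ, hτ,
    fun c hc => ?_, hψ⟩
  · obtain ⟨y, -, hy⟩ := exists_interior_point hc
    obtain ⟨s, hs, h⟩ := exists_carried (H (t, b y))
    exact ⟨s, hs, fun w hw => h _ (hψ t t (by simpa using hδ) y w (hy w hw))⟩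
  · obtain ⟨s, hs, h⟩ := hcar c hc
    exact ⟨s, hs, fun w hw => (h w hw).1, fun y hy => hsupp y c s hy fun w hw => (h w hw).2⟩

/-- Applied to a constant homotopy, the approximation gives `ψ ≃ g ∘ b`. The map `b` may be replaced
by the simplicial `τ`, as both carry a point into a common simplex. -/
theorem exists_approximation (g : C(Realization K, Realization Z)) :
    ∃ (V' : Type u) (_ : Fintype V') (K' : AbstractSimplicialComplex V')
      (τ : SimplicialMap K' K) (ψ : SimplicialMap K' Z), InDBar (faceSpaceMap τ) ∧
      ψ.realization.Homotopic (g.comp τ.realization) := by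
  obtain ⟨V', _, K', τ, b, δ, ψ, hδ, hτ, hcar, hψ⟩ :=
    exists_simplicial_approximation (g.comp (ContinuousMap.snd : C(I × Realization K, Realization K)))
  refine ⟨V', inferInstance, K', τ, ψ 0, hτ, .trans (g := g.comp b) ?_ (.comp (.refl g) ?_)⟩
  · refine homotopic_of_carried fun y => ?_
    obtain ⟨s, hs, h⟩ := exists_carried (g (b y))
    refine ⟨s, hs, carried_realization _ (s := Finset.univ.filter fun w => y.1 w ≠ 0)
      (fun w hw => by simpa using hw) (fun w hw => h _ ?_), h⟩
    exact hψ 0 0 (by simpa using hδ) y w (by simpa using hw)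
  · refine homotopic_of_carried fun y => ?_
    obtain ⟨c, hc, hy⟩ := exists_carried y
    obtain ⟨s, hs, h1, h2⟩ := hcar c hc
    exact ⟨s, hs, h2 y hy, carried_realization τ hy h1⟩

/-- The approximations `ψ t` are contiguous for nearby times, so membership of `X(ψ t)` in `D̄` is
locally constant, hence constant, on the interval. At the ends `ψ` is contiguous to `α ∘ τ` and `β ∘
τ`, and `τ` cancels by 2-out-of-3. -/
theorem inDBar_of_homotopic {α β : SimplicialMap K Z}
    (h : α.realization.Homotopic β.realization) (hα : InDBar (faceSpaceMap α)) :
    InDBar (faceSpaceMap β) := by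
  classical
  obtain ⟨H⟩ := h
  obtain ⟨V', _, K', τ, b, δ, ψ, hδ, hτ, hcar, hψ⟩ :=
    exists_simplicial_approximation H.toContinuousMap
  have hend : ∀ (t : I) (φ : SimplicialMap K Z), (∀ x, H (t, x) = φ.realization x) →
      Contiguous (ψ t) (φ.comp τ) := by
    intro t φ hφ
    refine contiguous_of_subset fun c hc => ?_
    obtain ⟨s, hs, h1, h2⟩ := hcar c hc
    obtain ⟨y, hyc, hy⟩ := exists_interior_point hc
    refine ⟨_, φ.image_mem s hs, fun w hw => ⟨?_, Finset.mem_image_of_mem _ (h1 w hw)⟩⟩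
    refine carried_realization φ (h2 y hyc) (fun v hv => Finset.mem_image_of_mem _ hv) _ ?_
    rw [← hφ]
    exact hψ t t (by simpa using hδ) y w (hy w hw)
  have hnear : ∀ t t', dist t' t < δ → Contiguous (ψ t) (ψ t') := by
    intro t t' ht
    refine contiguous_of_subset fun c hc => ?_
    obtain ⟨y, -, hy⟩ := exists_interior_point hc
    -- The single point `H (t', b y)`, with `y` interior to `c`, has nonzero coordinates at the
    -- images of `c` under both `ψ t` and `ψ t'`.
    obtain ⟨s, hs, h⟩ := exists_carried (H (t', b y))
    exact ⟨s, hs, fun w hw => ⟨h _ (hψ t t' ht y w (hy w hw)),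
      h _ (hψ t' t' (by simpa using hδ) y w (hy w hw))⟩⟩
  have hconst : IsLocallyConstant fun t => InDBar (faceSpaceMap (ψ t)) := by
    rw [IsLocallyConstant.iff_eventually_eq]
    intro t
    filter_upwards [Metric.ball_mem_nhds t hδ] with t' ht'
    exact propext (hnear t t' ht').inDBar_iff.symm
  have h0 : InDBar (faceSpaceMap (ψ 0)) := by
    rw [(hend 0 α fun x => H.apply_zero x).inDBar_iff, faceSpaceMap_comp]
    exact hα.comp hτ
  have h1 : InDBar (faceSpaceMap (ψ 1)) :=
    (hconst.apply_eq_of_preconnectedSpace 0 1).mp h0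
  rw [(hend 1 β fun x => H.apply_one x).inDBar_iff, faceSpaceMap_comp] at h1
  exact .of_comp_left hτ h1

end Approximation

/-! ### Simple homotopy equivalences lie in the class -/

/-- A deformation is represented by a roof of simplicial maps in the class. -/
theorem IsDeformation.exists_roof {V W : Type u} [Fintype V] [Fintype W]
    {K : AbstractSimplicialComplex V} {L : AbstractSimplicialComplex W}
    {g : C(Realization K, Realization L)} (hg : IsDeformation g) :
    ∃ (U : Type u) (_ : Fintype U) (M : AbstractSimplicialComplex U) (a : SimplicialMap M K)
      (c : SimplicialMap M L), InDBar (faceSpaceMap a) ∧ InDBar (faceSpaceMap c) ∧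
      c.realization.Homotopic (g.comp a.realization) := by
  induction hg with
  | refl K =>
    have h : InDBar (faceSpaceMap (SimplicialMap.id K)) := by
      refine .of_adjoint id fun s t => ?_
      have : faceSpaceMap (SimplicialMap.id K) s = s := by
        classical
        exact Subtype.ext (Finset.image_id (s := s.1))
      rw [this]
      rfl
    exact ⟨_, inferInstance, K, .id K, .id K, h, h, .refl _⟩
  | expansion i hi _ ih =>
    obtain ⟨U, _, M, a, c, ha, hc, h⟩ := ih
    refine ⟨U, inferInstance, M, a, i.comp c, ha, ?_, ?_⟩
    · rw [faceSpaceMap_comp]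
      exact hi.inDBar.comp hc
    · rw [realization_comp, ContinuousMap.comp_assoc]
      exact .comp (.refl _) h
  | inverse i r hi h1 h2 _ ih =>
    obtain ⟨U, _, M, a, c, ha, hc, h⟩ := ih
    -- The inverse `r` need not be simplicial, so the right leg is approximated after subdividing
    -- the top of the roof. Then `i ∘ ψ ≃ i ∘ r ∘ c ∘ τ ≃ c ∘ τ`, and cancelling `i` puts `ψ` in the
    -- class.
    obtain ⟨U', _, M', τ, ψ, hτ, hψ⟩ := exists_approximation (r.comp c.realization)
    refine ⟨U', inferInstance, M', a.comp τ, ψ, ?_, ?_, ?_⟩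
    · rw [faceSpaceMap_comp]
      exact ha.comp hτ
    · refine .of_comp_right hi.inDBar ?_
      rw [← faceSpaceMap_comp]
      refine inDBar_of_homotopic (α := c.comp τ) ?_ ?_
      · rw [realization_comp, realization_comp]
        have h3 := ContinuousMap.Homotopic.comp h2 (.refl (c.realization.comp τ.realization))
        exact (ContinuousMap.Homotopic.comp (.refl i.realization) hψ).trans h3 |>.symm
      · rw [faceSpaceMap_comp]
        exact hc.comp hτ
    · rw [realization_comp]
      exact hψ.trans (.comp (.comp (.refl r) h) (.refl τ.realization))

theorem IsSimpleHomotopyEquiv.inDBar {V W : Type u} [Fintype V] [Fintype W]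
    {K : AbstractSimplicialComplex V} {L : AbstractSimplicialComplex W} {φ : SimplicialMap K L}
    (h : IsSimpleHomotopyEquiv φ.realization) : InDBar (faceSpaceMap φ) := by
  obtain ⟨-, g, hg, hφg⟩ := h
  obtain ⟨U, _, M, a, c, ha, hc, hca⟩ := hg.exists_roof
  -- The leg `a` is cancelled: `φ ∘ a` is homotopic to `c` on realizations, and `c` is in the class.
  refine .of_comp_left ha ?_
  rw [← faceSpaceMap_comp]
  refine inDBar_of_homotopic (α := c) ?_ hc
  rw [realization_comp]
  exact hca.trans (.comp hφg.symm (.refl _))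

end SimpleHomotopy

/-- Part (a) concerns maps between finite T₀-spaces, part (b) simplicial maps between finite
simplicial complexes (with vertex sets `V` and `W`). -/
theorem mainTheorem2 :
    (∀ (X Y : Type u) [TopologicalSpace X] [Fintype X] [T0Space X]
        [TopologicalSpace Y] [Fintype Y] [T0Space Y] (f : C(X, Y)),
        SimpleHomotopy.InDBar f ↔
          SimpleHomotopy.IsSimpleHomotopyEquiv (SimpleHomotopy.orderComplexMap f).realization) ∧
    (∀ (V W : Type u) [Fintype V] [Fintype W]
        (K : AbstractSimplicialComplex V) (L : AbstractSimplicialComplex W)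
        (φ : SimpleHomotopy.SimplicialMap K L),
        SimpleHomotopy.IsSimpleHomotopyEquiv φ.realization ↔
          SimpleHomotopy.InDBar (SimpleHomotopy.faceSpaceMap φ)) :=
  ⟨fun _ _ _ _ _ _ _ _ f => ⟨fun h => h.isSimpleHomotopyEquiv, fun h =>
      (SimpleHomotopy.inDBar_iff_faceSpaceMap_orderComplexMap f).2 h.inDBar⟩,
    fun _ _ _ _ _ _ _ => ⟨fun h => h.inDBar,
      SimpleHomotopy.isSimpleHomotopyEquiv_of_inDBar_faceSpaceMap⟩⟩
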